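/- Let $\eta(\tau)=q^{1/24}\prod_{m=1}^\infty(1-q^m)$, where $q=e^{2\pi i\tau}$ and $\operatorname{Im}\tau>0$, be the Dedekind eta function, and for $n\in\mathbb{Z}$ let $a(n)$ denote the $n$-th Fourier coefficient of $\eta^{-24}$, so that $\eta(\tau)^{-24}=\sum_{n\in\mathbb{Z}}a(n)q^n$ for all $\tau$ with $\operatorname{Im}\tau>0$. For coprime integers $0\le h<k$ let $\omega_{h,k}=\exp(\pi i\,s(h,k))$ with the Dedekind sum $s(h,k)=\sum_{\mu=0}^{k-1}\left(\left(\frac{\mu}{k}\right)\right)\left(\left(\frac{h\mu}{k}\right)\right)$, where $((x))=0$ if $x\in\mathbb{Z}$ and $((x))=x-\lfloor x\rfloor-\frac12$ otherwise. Let $I_{13}(x)=\sum_{m=0}^\infty\frac{(x/2)^{2m+13}}{m!\,(m+13)!}$ be the modified Bessel function of the first kind of order $13$. Then $a(n)=0$ for $n<-1$, $a(-1)=1$ and $a(0)=24$. For every integer $n>0$, $$a(n)=\frac{2\pi}{n^{13/2}}\sum_{k=1}^\infty\frac1k\sum_{\substack{0\le h<k\\ \gcd(h,k)=1}}\omega_{h,k}^{24}\,e^{-\frac{2\pi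 i(n+1)h}{k}}\,I_{13}\!\left(\frac{4\pi}{k}\sqrt n\right),$$ where the series over $k$ converges absolutely. Moreover, as $n\to\infty$, $$a(n)=\frac{2\pi}{n^{13/2}}I_{13}(4\pi\sqrt n)\left(1+O\!\left(\frac1{e^{2\pi\sqrt n}}\right)\right)\sim\frac{2\pi}{n^{13/2}}\,\frac{e^{4\pi\sqrt n}}{\sqrt{8\pi^2\sqrt n}}.$$ -/

import Mathlib

/-- The `n`-th Fourier coefficient of the 1-periodic function `η⁻²⁴` on the upper half-plane,
as the Fourier integral along the horizontal segment from `i` to `1 + i`. -/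
noncomputable def etaCoeff (n : ℤ) : ℂ :=
  ∫ x in (0 : ℝ)..1, ModularForm.eta (x + Complex.I) ^ (-24 : ℤ) *
    Complex.exp (-(2 * Real.pi * Complex.I * n * (x + Complex.I)))

/-- The modified Bessel function of the first kind `I_ν`, of integer order `ν ≥ 0`. -/
noncomputable def besselI (ν : ℕ) (x : ℝ) : ℝ :=
  ∑' m : ℕ, (x / 2) ^ (2 * m + ν) / ((m.factorial : ℝ) * ((m + ν).factorial : ℝ))

/-- The sawtooth function `((x))`: zero at the integers, `x - ⌊x⌋ - 1/2` elsewhere. -/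
noncomputable def sawtooth (x : ℝ) : ℝ :=
  if (⌊x⌋ : ℝ) = x then 0 else x - ⌊x⌋ - 1 / 2

/-- The Dedekind sum `s(h, k)`. -/
noncomputable def dedekindSum (h k : ℕ) : ℝ :=
  ∑ μ ∈ Finset.range k, sawtooth ((μ : ℝ) / k) * sawtooth ((h : ℝ) * μ / k)

/-- The root of unity `ω_{h,k} = exp(π i s(h, k))`. -/
noncomputable def dedekindOmega (h k : ℕ) : ℂ :=
  Complex.exp (Real.pi * Complex.I * dedekindSum h k)

/-- The `k`-th term
`(1/k) ∑_{0 ≤ h < k, gcd(h,k) = 1} ω_{h,k}^24 e^{-2πi(n+1)h/k} I₁₃(4π√n/k)`. -/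
noncomputable def rademacherTerm (n : ℕ) (k : ℕ+) : ℂ :=
  1 / ((k : ℕ) : ℂ) * ∑ h ∈ (Finset.range (k : ℕ)).filter (fun h => Nat.gcd h k = 1),
    dedekindOmega h k ^ 24 *
      Complex.exp (-(2 * Real.pi * Complex.I * ((n : ℂ) + 1) * h / ((k : ℕ) : ℂ))) *
      (besselI 13 (4 * Real.pi / ((k : ℕ) : ℝ) * Real.sqrt n) : ℂ)

/-- The main term `2π n^{-13/2} I₁₃(4π√n)`. -/
noncomputable def etaMainTerm (n : ℕ) : ℝ :=
  2 * Real.pi / (n : ℝ) ^ (13 / 2 : ℝ) * besselI 13 (4 * Real.pi * Real.sqrt n)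

lemma tprod_one_sub_pow_ne_zero {q : ℂ} (hq : ‖q‖ < 1) : ∏' n : ℕ, (1 - q ^ (n + 1)) ≠ 0 := by
  have h := tprod_one_add_ne_zero_of_summable (f := fun n : ℕ ↦ -q ^ (n + 1)) ?_ ?_
  · simpa [sub_eq_add_neg] using h
  · intro n h0
    have : q ^ (n + 1) = 1 := by linear_combination -h0
    have h1 : ‖q‖ ^ (n + 1) = 1 := by rw [← norm_pow, this, norm_one]
    exact (pow_lt_one₀ (norm_nonneg q) hq (Nat.succ_ne_zero n)).ne h1
  · simpa using (summable_nat_add_iff 1).mpr (summable_geometric_of_lt_one (norm_nonneg _) hq)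

/-- The function `∏ (1 - q ^ (n + 1)) ^ (-24)` on the unit disc. -/
noncomputable def invEulerPow (q : ℂ) : ℂ := ((∏' n : ℕ, (1 - q ^ (n + 1))) ^ 24)⁻¹

/-- The Taylor coefficients of `invEulerPow` at `0`. -/
noncomputable def invEulerCoeff (m : ℕ) : ℂ := (m.factorial : ℂ)⁻¹ * iteratedDeriv m invEulerPow 0

lemma differentiableOn_invEulerPow : DifferentiableOn ℂ invEulerPow (Metric.ball 0 1) :=
  (ModularForm.differentiableOn_tprod_one_sub_pow.fun_pow 24).fun_inv fun _ hq ↦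
    pow_ne_zero _ (tprod_one_sub_pow_ne_zero (by simpa using hq))

lemma hasSum_invEulerCoeff {q : ℂ} (hq : ‖q‖ < 1) :
    HasSum (fun m : ℕ ↦ invEulerCoeff m * q ^ m) (invEulerPow q) := by
  have h := Complex.hasSum_taylorSeries_on_ball differentiableOn_invEulerPow
    (show q ∈ Metric.ball (0 : ℂ) 1 by simpa using hq)
  refine h.congr_fun fun m ↦ ?_
  simp [invEulerCoeff]
  ring

lemma invEulerCoeff_zero : invEulerCoeff 0 = 1 := by
  simp [invEulerCoeff, invEulerPow]

lemma hasDerivAt_tprod_one_sub_pow : HasDerivAt (fun q : ℂ ↦ ∏' n : ℕ, (1 - q ^ (n + 1))) (-1) 0 := by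
  set R : ℂ → ℂ := fun q ↦ ∏' n : ℕ, (1 - q ^ (n + 2)) with hR
  have hsum (q : ℂ) (hq : ‖q‖ < 1) : Summable fun n : ℕ ↦ ‖q ^ (n + 2)‖ := by
    simpa using (summable_nat_add_iff 2).mpr (summable_geometric_of_lt_one (norm_nonneg _) hq)
  have hmul (q : ℂ) (hq : ‖q‖ < 1) : Multipliable fun n : ℕ ↦ 1 - q ^ (n + 2) := by
    have := multipliable_one_add_of_summable (f := fun n : ℕ ↦ -q ^ (n + 2))
      (by simpa using hsum q hq)
    simpa [sub_eq_add_neg] using this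
  have hbound (q : ℂ) (hq : ‖q‖ ≤ 1 / 2) : ‖R q - 1‖ ≤ Real.exp (2 * ‖q‖ ^ 2) - 1 := by
    have hq1 : ‖q‖ < 1 := by linarith
    have ht := (hmul q hq1).hasProd
    refine le_of_tendsto (ht.sub_const 1).norm (Filter.Eventually.of_forall fun s ↦ ?_)
    have h1 := Finset.norm_prod_one_add_sub_one_le s (fun n : ℕ ↦ -q ^ (n + 2))
    simp only [← sub_eq_add_neg] at h1
    refine h1.trans (sub_le_sub_right (Real.exp_le_exp.mpr ?_) 1)
    calc ∑ i ∈ s, ‖-q ^ (i + 2)‖ = ∑ i ∈ s, ‖q ^ (i + 2)‖ := by simp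
      _ ≤ ∑' i : ℕ, ‖q ^ (i + 2)‖ := (hsum q hq1).sum_le_tsum _ fun _ _ ↦ norm_nonneg _
      _ = ‖q‖ ^ 2 * (1 - ‖q‖)⁻¹ := by
          rw [← tsum_geometric_of_lt_one (norm_nonneg q) hq1, ← tsum_mul_left]
          exact tsum_congr fun n ↦ by rw [norm_pow]; ring
      _ ≤ ‖q‖ ^ 2 * 2 := by
          gcongr
          rw [inv_le_comm₀ (by linarith) (by norm_num)]
          linarith
      _ = _ := by ring
  have hR0 : R 0 = 1 := by simp [hR]
  have hRd : HasDerivAt R 0 0 := by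
    rw [hasDerivAt_iff_isLittleO_nhds_zero]
    have hO : (fun h : ℂ ↦ R (0 + h) - R 0 - h • (0 : ℂ)) =O[nhds 0] fun h : ℂ ↦ ‖h‖ ^ 2 := by
      refine Asymptotics.IsBigO.of_bound 4 ?_
      filter_upwards [Metric.closedBall_mem_nhds (0 : ℂ) (show (0 : ℝ) < 1 / 2 by norm_num)] with q hq
      have hq : ‖q‖ ≤ 1 / 2 := by simpa using hq
      have h1 := hbound q hq
      have h2 : |2 * ‖q‖ ^ 2| ≤ 1 := by
        rw [abs_of_nonneg (by positivity)]; nlinarith [norm_nonneg q]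
      have h3 := Real.abs_exp_sub_one_le h2
      have h4 := (le_abs_self _).trans h3
      rw [abs_of_nonneg (by positivity)] at h4
      simp only [zero_add, hR0, smul_zero, sub_zero, norm_pow, norm_norm]
      linarith
    refine hO.trans_isLittleO ?_
    have := Asymptotics.isLittleO_norm_pow_id (E' := ℂ) (one_lt_two)
    simpa using this
  have hprod : (fun q : ℂ ↦ ∏' n : ℕ, (1 - q ^ (n + 1))) =ᶠ[nhds 0] fun q ↦ (1 - q) * R q := by
    filter_upwards [Metric.ball_mem_nhds (0 : ℂ) one_pos] with q hq
    have h := tprod_eq_zero_mul' (f := fun n : ℕ ↦ 1 - q ^ (n + 1))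
      (hmul q (by simpa using hq))
    simpa [hR] using h
  refine HasDerivAt.congr_of_eventuallyEq ?_ hprod
  have := ((hasDerivAt_id (0 : ℂ)).const_sub 1).fun_mul hRd
  exact this.congr_deriv (by simp [hR0])

lemma invEulerCoeff_one : invEulerCoeff 1 = 24 := by
  have h := (hasDerivAt_tprod_one_sub_pow.fun_pow 24).fun_inv (by simp)
  have h2 : HasDerivAt invEulerPow 24 0 := h.congr_deriv (by simp)
  simp [invEulerCoeff, h2.deriv]

lemma norm_exp_two_pi_I_mul (τ : ℂ) (hτ : 0 < τ.im) :
    ‖Complex.exp (2 * Real.pi * Complex.I * τ)‖ < 1 :=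
  UpperHalfPlane.norm_exp_two_pi_I_lt_one ⟨τ, hτ⟩

lemma eta_zpow_eq (τ : ℂ) : ModularForm.eta τ ^ (-24 : ℤ) =
    Complex.exp (-(2 * Real.pi * Complex.I * τ)) *
      invEulerPow (Complex.exp (2 * Real.pi * Complex.I * τ)) := by
  have h24 : Function.Periodic.qParam 24 τ ^ 24 = Complex.exp (2 * Real.pi * Complex.I * τ) := by
    rw [Function.Periodic.qParam, ← Complex.exp_nat_mul]
    congr 1
    push_cast
    ring
  have : ∏' n, (1 - ModularForm.eta_q n τ) =
      ∏' n : ℕ, (1 - Complex.exp (2 * Real.pi * Complex.I * τ) ^ (n + 1)) :=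
    tprod_congr fun n ↦ by rw [ModularForm.eta_q_eq_pow]
  rw [zpow_neg, show (24 : ℤ) = ((24 : ℕ) : ℤ) from rfl, zpow_natCast, ModularForm.eta, mul_pow, h24,
    this, mul_inv, ← Complex.exp_neg]
  rfl

lemma hasSum_eta_zpow {τ : ℂ} (hτ : 0 < τ.im) :
    HasSum (fun m : ℕ ↦ invEulerCoeff m * Complex.exp (2 * Real.pi * Complex.I * (m + (-1 : ℤ)) * τ))
      (ModularForm.eta τ ^ (-24 : ℤ)) := by
  rw [eta_zpow_eq]
  refine ((hasSum_invEulerCoeff (norm_exp_two_pi_I_mul τ hτ)).mul_left _).congr_fun fun m ↦ ?_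
  rw [← Complex.exp_nat_mul, mul_left_comm, ← Complex.exp_add]
  congr 2
  push_cast
  ring

lemma summable_norm_invEulerCoeff {r : ℝ} (hr0 : 0 ≤ r) (hr : r < 1) :
    Summable fun m : ℕ ↦ ‖invEulerCoeff m‖ * r ^ m := by
  have := (hasSum_invEulerCoeff (q := (r : ℂ)) (by simpa [abs_of_nonneg hr0] using hr)).summable.norm
  simpa [abs_of_nonneg hr0] using this

lemma integral_exp_two_pi_I_mul_int (k : ℤ) :
    ∫ x in (0 : ℝ)..1, Complex.exp (2 * Real.pi * Complex.I * k * (x + Complex.I)) =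
      if k = 0 then 1 else 0 := by
  split_ifs with hk
  · simp [hk]
  · have hc : 2 * Real.pi * Complex.I * k ≠ 0 := by
      simp [hk, Real.pi_ne_zero]
    have h1 : Complex.exp (2 * Real.pi * Complex.I * k) = 1 :=
      Complex.exp_eq_one_iff.mpr ⟨k, by ring⟩
    simp_rw [mul_add, Complex.exp_add]
    rw [intervalIntegral.integral_mul_const, integral_exp_mul_complex hc]
    simp [h1]

lemma etaCoeff_eq_tsum (n : ℤ) :
    HasSum (fun m : ℕ ↦ if (m : ℤ) = n + 1 then invEulerCoeff m else 0) (etaCoeff n) := by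
  have hIm (x : ℝ) : 0 < ((x : ℂ) + Complex.I).im := by simp
  set F : ℕ → ℝ → ℂ := fun m x ↦ invEulerCoeff m *
    Complex.exp (2 * Real.pi * Complex.I * ((m - 1 - n : ℤ) : ℂ) * (x + Complex.I)) with hF
  set r : ℝ := Real.exp (-(2 * Real.pi)) with hr
  have hr1 : r < 1 := by rw [hr, Real.exp_lt_one_iff]; have := Real.pi_pos; linarith
  have hnorm (m : ℕ) (x : ℝ) : ‖F m x‖ = ‖invEulerCoeff m‖ * r ^ m * Real.exp (2 * Real.pi * (n + 1)) := by
    rw [hF, norm_mul, Complex.norm_exp, hr, ← Real.exp_nat_mul,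
      mul_assoc ‖invEulerCoeff m‖, ← Real.exp_add]
    congr 2
    simp
    ring
  have key := intervalIntegral.hasSum_integral_of_dominated_convergence (F := F)
    (f := fun x : ℝ ↦ ModularForm.eta (x + Complex.I) ^ (-24 : ℤ) *
      Complex.exp (-(2 * Real.pi * Complex.I * n * (x + Complex.I))))
    (μ := MeasureTheory.volume) (a := 0) (b := 1)
    (fun m _ ↦ ‖invEulerCoeff m‖ * r ^ m * Real.exp (2 * Real.pi * (n + 1)))
    (fun m ↦ by
      have : Continuous (F m) := by simp only [hF]; fun_prop
      exact this.aestronglyMeasurable)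
    (fun m ↦ Filter.Eventually.of_forall fun x _ ↦ (hnorm m x).le)
    (Filter.Eventually.of_forall fun x _ ↦
      (summable_norm_invEulerCoeff (Real.exp_pos _).le hr1).mul_right _)
    (by simp)
    (Filter.Eventually.of_forall fun x _ ↦ by
      refine ((hasSum_eta_zpow (hIm x)).mul_right _).congr_fun fun m ↦ ?_
      simp only [hF]
      rw [mul_assoc (invEulerCoeff m), ← Complex.exp_add]
      congr 2
      push_cast
      ring)
  refine key.congr_fun fun m ↦ ?_
  simp only [hF]
  rw [intervalIntegral.integral_const_mul, integral_exp_two_pi_I_mul_int]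
  have : ((m : ℤ) - 1 - n = 0) ↔ ((m : ℤ) = n + 1) := by omega
  simp [this]

lemma etaCoeff_of_lt (n : ℤ) (hn : n < -1) : etaCoeff n = 0 := by
  refine (etaCoeff_eq_tsum n).unique ?_
  convert hasSum_zero with m
  rw [if_neg (by omega)]

lemma etaCoeff_sub_one (m : ℕ) : etaCoeff ((m : ℤ) + (-1 : ℤ)) = invEulerCoeff m := by
  refine (etaCoeff_eq_tsum _).unique ?_
  convert hasSum_ite_eq m (invEulerCoeff m) using 2 with j
  simp only [neg_add_cancel_right, Nat.cast_inj]
  split_ifs with h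
  · rw [h]
  · rfl

lemma hasSum_etaCoeff {τ : ℂ} (hτ : 0 < τ.im) :
    HasSum (fun n : ℤ ↦ etaCoeff n * Complex.exp (2 * Real.pi * Complex.I * n * τ))
      (ModularForm.eta τ ^ (-24 : ℤ)) := by
  have hinj : Function.Injective fun m : ℕ ↦ (m : ℤ) + (-1 : ℤ) := fun a b h ↦ by
    simpa using h
  rw [← hinj.hasSum_iff]
  · refine (hasSum_eta_zpow hτ).congr_fun ?_ |> id
    intro m
    simp only [Function.comp, etaCoeff_sub_one]
    push_cast
    rfl
  · intro n hn
    rw [etaCoeff_of_lt, zero_mul]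
    by_contra! h
    exact hn ⟨(n + 1).toNat, by simp; omega⟩

lemma sawtooth_natCast_div {k : ℕ} (hk : 0 < k) (a : ℕ) :
    sawtooth ((a : ℝ) / k) = if a % k = 0 then 0 else ((a % k : ℕ) : ℝ) / k - 1 / 2 := by
  have hk' : (k : ℝ) ≠ 0 := by positivity
  have hfl : ⌊(a : ℝ) / k⌋ = ((a / k : ℕ) : ℤ) := by
    rw [Int.floor_eq_iff]
    have h1 : ((a / k : ℕ) : ℝ) ≤ (a : ℝ) / k := Nat.cast_div_le
    have h2 : (a : ℝ) / k < ((a / k : ℕ) : ℝ) + 1 := by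
      rw [div_lt_iff₀ (by positivity)]
      have := Nat.lt_div_mul_add (a := a) hk
      have h3 : a < (a / k + 1) * k := by linarith
      exact_mod_cast h3
    rw [Int.cast_natCast]
    exact ⟨h1, h2⟩
  have hmod : (a : ℝ) = k * ((a / k : ℕ) : ℝ) + ((a % k : ℕ) : ℝ) := by
    exact_mod_cast (Nat.div_add_mod a k).symm
  have hsub : (a : ℝ) / k - ((a / k : ℕ) : ℝ) = ((a % k : ℕ) : ℝ) / k := by
    field_simp
    linarith
  rw [sawtooth, hfl, Int.cast_natCast]
  have hiff : ((a / k : ℕ) : ℝ) = (a : ℝ) / k ↔ a % k = 0 := by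
    rw [eq_comm, ← sub_eq_zero, hsub, div_eq_zero_iff]
    simp [hk']
  simp only [hiff, hsub]

lemma sum_range_mul_mod {M : Type*} [AddCommMonoid M] {h k : ℕ} (hk : 0 < k)
    (hc : Nat.gcd h k = 1) (g : ℕ → M) :
    ∑ μ ∈ Finset.range k, g (h * μ % k) = ∑ μ ∈ Finset.range k, g μ := by
  have hmaps : ∀ μ ∈ Finset.range k, h * μ % k ∈ Finset.range k := fun μ _ ↦
    Finset.mem_range.mpr (Nat.mod_lt _ hk)
  have hinj : Set.InjOn (fun μ ↦ h * μ % k) (Finset.range k : Set ℕ) := by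
    intro a ha b hb hab
    have ha' : a < k := by simpa using ha
    have hb' : b < k := by simpa using hb
    have : a ≡ b [MOD k] := Nat.ModEq.cancel_left_of_coprime (by rwa [Nat.gcd_comm]) hab
    rwa [Nat.ModEq, Nat.mod_eq_of_lt ha', Nat.mod_eq_of_lt hb'] at this
  exact Finset.sum_nbij _ hmaps hinj (Finset.surjOn_of_injOn_of_card_le _ hmaps hinj le_rfl)
    fun _ _ ↦ rfl

lemma dedekindSum_eq {h k : ℕ} (hk : 0 < k) (hc : Nat.gcd h k = 1) :
    dedekindSum h k = ((∑ μ ∈ Finset.range k, μ * (h * μ % k) : ℕ) : ℝ) / k ^ 2 - (k - 1) / 4 := by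
  have hk' : (k : ℝ) ≠ 0 := by positivity
  have hterm : ∀ μ ∈ Finset.range k, sawtooth ((μ : ℝ) / k) * sawtooth ((h : ℝ) * μ / k) =
      ((μ : ℝ) * ((h * μ % k : ℕ) : ℝ) / k ^ 2 - (μ : ℝ) / (2 * k) - ((h * μ % k : ℕ) : ℝ) / (2 * k)
        + 1 / 4) - if μ = 0 then 1 / 4 else 0 := by
    intro μ hμ
    have hμ' : μ < k := Finset.mem_range.mp hμ
    have hcast : (h : ℝ) * μ = ((h * μ : ℕ) : ℝ) := by push_cast; rfl
    rw [hcast, sawtooth_natCast_div hk, sawtooth_natCast_div hk, Nat.mod_eq_of_lt hμ']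
    rcases eq_or_ne μ 0 with rfl | h0
    · simp
    · have h1 : h * μ % k ≠ 0 := fun h1 ↦ by
        have : k ∣ μ := Nat.Coprime.dvd_of_dvd_mul_left (by rwa [Nat.coprime_comm])
          (Nat.dvd_of_mod_eq_zero h1)
        exact h0 (Nat.eq_zero_of_dvd_of_lt this hμ')
      rw [if_neg h0, if_neg h1, if_neg h0]
      field_simp
      ring
  have hS : ∑ μ ∈ Finset.range k, (μ : ℝ) = k * (k - 1) / 2 := by
    have := Finset.sum_range_id_mul_two k
    have h2 : ((∑ i ∈ Finset.range k, i : ℕ) : ℝ) * 2 = k * ((k - 1 : ℕ) : ℝ) := by exact_mod_cast this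
    rw [Nat.cast_sub (by omega)] at h2
    push_cast at h2
    linarith
  have hS2 : ∑ μ ∈ Finset.range k, ((h * μ % k : ℕ) : ℝ) = k * (k - 1) / 2 := by
    rw [← hS]
    exact sum_range_mul_mod hk hc fun μ ↦ (μ : ℝ)
  rw [dedekindSum, Finset.sum_congr rfl hterm, Finset.sum_sub_distrib, Finset.sum_add_distrib,
    Finset.sum_sub_distrib, Finset.sum_sub_distrib, ← Finset.sum_div, ← Finset.sum_div,
    ← Finset.sum_div, hS, hS2, Finset.sum_ite_eq' ]
  simp only [Finset.mem_range, hk, if_true, Finset.sum_const, Finset.card_range, nsmul_eq_mul]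
  push_cast
  field_simp
  ring

lemma twelve_mul_sum_mod {h k : ℕ} (hk : 0 < k) (hc : Nat.gcd h k = 1) {h' : ℤ}
    (hh' : (k : ℤ) ∣ h * h' - 1) :
    (k : ℤ) ^ 2 ∣ 12 * ((∑ μ ∈ Finset.range k, μ * (h * μ % k) : ℕ) : ℤ) - k * (h + h') := by
  have hY : 6 * (∑ μ ∈ Finset.range k, (μ : ℤ) ^ 2) = k * (k - 1) * (2 * k - 1) := by
    clear hk hc hh'
    induction k with
    | zero => simp
    | succ n ih => rw [Finset.sum_range_succ, mul_add, ih]; push_cast; ring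
  have hY2 : ∑ μ ∈ Finset.range k, ((h * μ % k : ℕ) : ℤ) ^ 2 = ∑ μ ∈ Finset.range k, (μ : ℤ) ^ 2 :=
    sum_range_mul_mod hk hc fun μ ↦ (μ : ℤ) ^ 2
  have hdvd : (k : ℤ) ^ 2 ∣ ∑ μ ∈ Finset.range k, (((h * μ % k : ℕ) : ℤ) - h * μ) ^ 2 := by
    refine Finset.dvd_sum fun μ _ ↦ pow_dvd_pow_of_dvd ?_ 2
    rw [← Int.modEq_iff_dvd]
    push_cast
    exact (Int.mod_modEq _ _).symm
  have hexp : ∑ μ ∈ Finset.range k, (((h * μ % k : ℕ) : ℤ) - h * μ) ^ 2 =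
      (1 + (h : ℤ) ^ 2) * ∑ μ ∈ Finset.range k, (μ : ℤ) ^ 2
        - 2 * h * ((∑ μ ∈ Finset.range k, μ * (h * μ % k) : ℕ) : ℤ) := by
    have : ∀ μ ∈ Finset.range k, (((h * μ % k : ℕ) : ℤ) - h * μ) ^ 2 =
        ((h * μ % k : ℕ) : ℤ) ^ 2 + (h : ℤ) ^ 2 * (μ : ℤ) ^ 2 - 2 * h * ((μ * (h * μ % k) : ℕ) : ℤ) := by
      intro μ _
      push_cast
      ring
    rw [Finset.sum_congr rfl this, Finset.sum_sub_distrib, Finset.sum_add_distrib, hY2,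
      ← Finset.mul_sum, ← Finset.mul_sum, Nat.cast_sum]
    ring
  rw [hexp] at hdvd
  obtain ⟨t, ht⟩ := hdvd
  obtain ⟨u, hu⟩ := hh'
  have hcop : IsCoprime ((k : ℤ) ^ 2) h :=
    IsCoprime.pow_left (Int.isCoprime_iff_gcd_eq_one.mpr (by rw [Int.gcd_natCast_natCast, Nat.gcd_comm]; exact hc))
  refine hcop.dvd_of_dvd_mul_left ⟨(1 + (h : ℤ) ^ 2) * (2 * k - 3) - 6 * t - u, ?_⟩
  linear_combination (1 + (h : ℤ) ^ 2) * hY - 6 * ht - (k : ℤ) * hu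

lemma dedekindOmega_pow {h k : ℕ} (hk : 0 < k) (hc : Nat.gcd h k = 1) {h' : ℤ}
    (hh' : (k : ℤ) ∣ h * h' - 1) :
    dedekindOmega h k ^ 24 = Complex.exp (2 * Real.pi * Complex.I * (h + h') / k) := by
  obtain ⟨t, ht⟩ := twelve_mul_sum_mod hk hc hh'
  have hk' : (k : ℂ) ≠ 0 := by exact_mod_cast hk.ne'
  have htC : 12 * ((∑ μ ∈ Finset.range k, μ * (h * μ % k) : ℕ) : ℂ) - k * (h + h') =
      (k : ℂ) ^ 2 * t := by
    generalize (∑ μ ∈ Finset.range k, μ * (h * μ % k)) = X at ht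
    exact_mod_cast congrArg (Int.cast : ℤ → ℂ) ht
  have hs : (12 * dedekindSum h k : ℂ) = (h + h') / k + ((t - 3 * (k - 1) : ℤ) : ℂ) := by
    rw [dedekindSum_eq hk hc]
    push_cast at htC ⊢
    field_simp
    linear_combination 4 * htC
  rw [dedekindOmega, ← Complex.exp_nat_mul, Complex.exp_eq_exp_iff_exists_int]
  refine ⟨t - 3 * (k - 1), ?_⟩
  push_cast at hs ⊢
  linear_combination (2 * Real.pi * Complex.I) * hs

section bessel

open MeasureTheory Filter Topology

lemma hasSum_cexp (z : ℂ) : HasSum (fun n : ℕ ↦ z ^ n / (n.factorial : ℂ)) (Complex.exp z) := by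
  rw [Complex.exp_eq_exp_ℂ]
  exact NormedSpace.expSeries_div_hasSum_exp z

lemma HasSum.mul_of_complete {ι κ : Type*} {f : ι → ℂ} {g : κ → ℂ} {s t : ℂ} (hf : HasSum f s)
    (hg : HasSum g t) : HasSum (fun p : ι × κ ↦ f p.1 * g p.2) (s * t) :=
  have h : Summable (fun p : ι × κ ↦ f p.1 * g p.2) :=
    summable_mul_of_summable_norm hf.summable.norm hg.summable.norm
  HasSum.mul hf hg h

lemma summable_besselI (ν : ℕ) (x : ℝ) : Summable fun m : ℕ ↦
    (x / 2) ^ (2 * m + ν) / ((m.factorial : ℝ) * ((m + ν).factorial : ℝ)) := by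
  refine Summable.of_norm_bounded
    (g := fun m : ℕ ↦ |x / 2| ^ ν * (((x / 2) ^ 2) ^ m / (m.factorial : ℝ)))
    ((Real.summable_pow_div_factorial _).mul_left _) fun m ↦ ?_
  rw [Real.norm_eq_abs, abs_div, abs_pow, pow_add, pow_mul, sq_abs, abs_of_nonneg (a := _ * _) (by positivity)]
  have h1 : (1 : ℝ) ≤ ((m + ν).factorial : ℝ) := by exact_mod_cast Nat.factorial_pos _
  calc ((x / 2) ^ 2) ^ m * |x / 2| ^ ν / ((m.factorial : ℝ) * ((m + ν).factorial : ℝ))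
      ≤ ((x / 2) ^ 2) ^ m * |x / 2| ^ ν / ((m.factorial : ℝ) * 1) := by gcongr
    _ = _ := by ring

lemma besselI_pos (ν : ℕ) {x : ℝ} (hx : 0 < x) : 0 < besselI ν x :=
  (summable_besselI ν x).tsum_pos (fun m ↦ by positivity) 0 (by positivity)

lemma besselI_mul_le (ν : ℕ) {t x : ℝ} (ht : 0 ≤ t) (ht1 : t ≤ 1) (hx : 0 ≤ x) :
    besselI ν (t * x) ≤ t ^ ν * besselI ν x := by
  rw [besselI, besselI, ← tsum_mul_left]
  refine (summable_besselI ν _).tsum_le_tsum (fun m ↦ ?_) ((summable_besselI ν x).mul_left _)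
  have h1 : (t * x / 2) ^ (2 * m + ν) = t ^ (2 * m) * t ^ ν * (x / 2) ^ (2 * m + ν) := by
    rw [← pow_add, ← mul_pow]
    ring
  rw [h1, ← mul_div_assoc]
  gcongr
  exact mul_le_of_le_one_left (by positivity) (pow_le_one₀ ht ht1)

lemma integral_exp_int_mul_I (j : ℤ) :
    ∫ θ in (-Real.pi)..Real.pi, Complex.exp (j * θ * Complex.I) =
      ((if j = 0 then 2 * Real.pi else 0 : ℝ) : ℂ) := by
  split_ifs with hj
  · simp [hj]
    ring
  · have hc : (j : ℂ) * Complex.I ≠ 0 := by simp [hj]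
    have h1 (θ : ℝ) : Complex.exp (j * θ * Complex.I) = Complex.exp (j * Complex.I * θ) := by
      ring_nf
    simp_rw [h1]
    rw [integral_exp_mul_complex hc]
    have : Complex.exp (j * Complex.I * (Real.pi : ℝ)) =
        Complex.exp (j * Complex.I * ((-Real.pi : ℝ) : ℂ)) := by
      rw [Complex.exp_eq_exp_iff_exists_int]
      exact ⟨j, by push_cast; ring⟩
    rw [this, sub_self, zero_div, Complex.ofReal_zero]

/-- The general term of the Fourier expansion of `exp (x cos θ - iνθ)`. -/
noncomputable def besselFourierTerm (ν : ℕ) (x : ℝ) (p : ℕ × ℕ) (θ : ℝ) : ℂ :=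
  (((x / 2) ^ p.1 / (p.1.factorial : ℝ) * ((x / 2) ^ p.2 / (p.2.factorial : ℝ)) : ℝ) : ℂ) *
    Complex.exp (((p.1 - p.2 - ν : ℤ) : ℂ) * θ * Complex.I)

lemma norm_besselFourierTerm (ν : ℕ) (x : ℝ) (p : ℕ × ℕ) (θ : ℝ) :
    ‖besselFourierTerm ν x p θ‖ =
      |x / 2| ^ p.1 / (p.1.factorial : ℝ) * (|x / 2| ^ p.2 / (p.2.factorial : ℝ)) := by
  have : ((p.1 - p.2 - ν : ℤ) : ℂ) * θ * Complex.I =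
      (((p.1 - p.2 - ν : ℤ) * θ : ℝ) : ℂ) * Complex.I := by push_cast; ring
  rw [besselFourierTerm, norm_mul, this, Complex.norm_exp_ofReal_mul_I, mul_one, Complex.norm_real,
    Real.norm_eq_abs, abs_mul, abs_div, abs_div, abs_pow, abs_pow, Nat.abs_cast, Nat.abs_cast]

lemma besselFourierTerm_eq (ν : ℕ) (x θ : ℝ) (p : ℕ × ℕ) : besselFourierTerm ν x p θ =
    (((x / 2 : ℝ) : ℂ) * Complex.exp (θ * Complex.I)) ^ p.1 / (p.1.factorial : ℂ) *
      ((((x / 2 : ℝ) : ℂ) * Complex.exp (-(θ * Complex.I))) ^ p.2 / (p.2.factorial : ℂ)) *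
        Complex.exp (-(ν * θ * Complex.I)) := by
  have h5 : Complex.exp (((p.1 - p.2 - ν : ℤ) : ℂ) * θ * Complex.I) =
      Complex.exp (θ * Complex.I) ^ p.1 * Complex.exp (-(θ * Complex.I)) ^ p.2 *
        Complex.exp (-(ν * θ * Complex.I)) := by
    rw [← Complex.exp_nat_mul, ← Complex.exp_nat_mul, ← Complex.exp_add, ← Complex.exp_add]
    congr 1
    push_cast
    ring
  rw [besselFourierTerm, h5, mul_pow, mul_pow]
  push_cast
  ring

lemma exp_mul_cos_eq (x θ : ℝ) : Complex.exp (x * Real.cos θ) =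
    Complex.exp (((x / 2 : ℝ) : ℂ) * Complex.exp (θ * Complex.I)) *
      Complex.exp (((x / 2 : ℝ) : ℂ) * Complex.exp (-(θ * Complex.I))) := by
  rw [← Complex.exp_add, Complex.ofReal_cos, Complex.cos, neg_mul]
  congr 1
  push_cast
  ring

lemma hasSum_besselFourierTerm (ν : ℕ) (x θ : ℝ) :
    HasSum (fun p ↦ besselFourierTerm ν x p θ)
      (Complex.exp (x * Real.cos θ) * Complex.exp (-(ν * θ * Complex.I))) := by
  have hmul (a b : ℂ) : HasSum (fun p : ℕ × ℕ ↦ a ^ p.1 / (p.1.factorial : ℂ) *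
      (b ^ p.2 / (p.2.factorial : ℂ))) (Complex.exp a * Complex.exp b) :=
    HasSum.mul_of_complete (f := fun n : ℕ ↦ a ^ n / (n.factorial : ℂ))
      (g := fun n : ℕ ↦ b ^ n / (n.factorial : ℂ)) (hasSum_cexp a) (hasSum_cexp b)
  rw [exp_mul_cos_eq]
  exact ((hmul _ _).mul_right _).congr_fun fun p ↦ besselFourierTerm_eq ν x θ p

lemma integral_besselFourierTerm (ν : ℕ) (x : ℝ) (p : ℕ × ℕ) :
    ∫ θ in (-Real.pi)..Real.pi, besselFourierTerm ν x p θ =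
      (((x / 2) ^ p.1 / (p.1.factorial : ℝ) * ((x / 2) ^ p.2 / (p.2.factorial : ℝ)) : ℝ) : ℂ) *
        ((if ((p.1 : ℤ) - p.2 - ν) = 0 then 2 * Real.pi else 0 : ℝ) : ℂ) := by
  simp only [besselFourierTerm]
  rw [intervalIntegral.integral_const_mul, integral_exp_int_mul_I]

lemma hasSum_integral_besselFourierTerm (ν : ℕ) (x : ℝ) :
    HasSum (fun p ↦ ∫ θ in (-Real.pi)..Real.pi, besselFourierTerm ν x p θ)
      (∫ θ in (-Real.pi)..Real.pi,
        Complex.exp (x * Real.cos θ) * Complex.exp (-(ν * θ * Complex.I))) := by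
  have hsum : Summable fun p : ℕ × ℕ ↦ |x / 2| ^ p.1 / (p.1.factorial : ℝ) *
    (|x / 2| ^ p.2 / (p.2.factorial : ℝ)) :=
    (Real.summable_pow_div_factorial |x / 2|).mul_of_nonneg (Real.summable_pow_div_factorial |x / 2|)
      (fun _ ↦ by positivity) (fun _ ↦ by positivity)
  refine intervalIntegral.hasSum_integral_of_dominated_convergence
    (fun p _ ↦ |x / 2| ^ p.1 / (p.1.factorial : ℝ) * (|x / 2| ^ p.2 / (p.2.factorial : ℝ)))
    (fun p ↦ ?_) (fun p ↦ Filter.Eventually.of_forall fun θ _ ↦ (norm_besselFourierTerm ν x p θ).le)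
    (Filter.Eventually.of_forall fun _ _ ↦ hsum) intervalIntegrable_const
    (Filter.Eventually.of_forall fun θ _ ↦ hasSum_besselFourierTerm ν x θ)
  have : Continuous (besselFourierTerm ν x p) := by unfold besselFourierTerm; fun_prop
  exact this.aestronglyMeasurable

/-- Bessel's integral for the modified Bessel function of integer order. -/
lemma integral_exp_cos_eq_besselI (ν : ℕ) (x : ℝ) :
    ∫ θ in (-Real.pi)..Real.pi, Complex.exp (x * Real.cos θ) * Complex.exp (-(ν * θ * Complex.I)) =
      ((2 * Real.pi * besselI ν x : ℝ) : ℂ) := by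
  have key := hasSum_integral_besselFourierTerm ν x
  have hinj : Function.Injective fun b : ℕ ↦ (b + ν, b) := fun a b h ↦ by
    simpa using congrArg Prod.snd h
  rw [← hinj.hasSum_iff] at key
  · refine key.unique ?_
    have h := (summable_besselI ν x).hasSum.mul_left (2 * Real.pi)
    rw [← besselI] at h
    refine (Complex.hasSum_ofReal.mpr h).congr_fun fun b ↦ ?_
    rw [Function.comp, integral_besselFourierTerm, if_pos (by push_cast; ring), ← Complex.ofReal_mul,
      Complex.ofReal_inj, show 2 * b + ν = b + ν + b by ring, pow_add _ (b + ν) b]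
    field_simp
  · intro p hp
    rw [integral_besselFourierTerm, if_neg, Complex.ofReal_zero, mul_zero]
    intro h
    refine hp ⟨p.2, Prod.ext ?_ rfl⟩
    simp only
    omega

lemma tendsto_mul_one_sub_cos_div_sqrt (u : ℝ) :
    Tendsto (fun x : ℝ ↦ x * (1 - Real.cos (u / √x))) atTop (𝓝 (u ^ 2 / 2)) := by
  have hs : Tendsto (fun x : ℝ ↦ u / √x / 2) atTop (𝓝 0) := by
    have := (tendsto_const_nhds (x := u)).div_atTop Real.tendsto_sqrt_atTop
    simpa using this.div_const 2
  have h1 : Tendsto (fun x : ℝ ↦ u ^ 2 / 2 * Real.sinc (u / √x / 2) ^ 2) atTop (𝓝 (u ^ 2 / 2)) := by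
    have := (((Real.continuous_sinc.tendsto 0).comp hs).pow 2).const_mul (u ^ 2 / 2)
    simpa using this
  refine h1.congr' ?_
  filter_upwards [eventually_gt_atTop 0] with x hx
  have hsin : Real.sin (u / √x / 2) = (u / √x / 2) * Real.sinc (u / √x / 2) := by
    rcases eq_or_ne (u / √x / 2) 0 with h0 | h0
    · simp [h0]
    · rw [Real.sinc_of_ne_zero h0, mul_div_cancel₀ _ h0]
  have hcos : 1 - Real.cos (u / √x) = 2 * Real.sin (u / √x / 2) ^ 2 := by
    have h2 := Real.cos_two_mul (u / √x / 2)
    have h3 := Real.sin_sq_add_cos_sq (u / √x / 2)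
    rw [show 2 * (u / √x / 2) = u / √x by ring] at h2
    rw [h2]
    linarith
  have hxx : √x ^ 2 = x := Real.sq_sqrt hx.le
  rw [hcos, hsin, mul_pow, div_pow, div_pow, hxx]
  field_simp

/-- The asymptotic behaviour `I_ν(x) ~ e ^ x / √(2πx)`. -/
lemma tendsto_besselI (ν : ℕ) :
    Tendsto (fun x : ℝ ↦ besselI ν x * (√(2 * Real.pi * x) * Real.exp (-x))) atTop (𝓝 1) := by
  have hpi := Real.pi_pos
  set g : ℝ → ℝ → ℂ := fun x u ↦ (Set.Ioc (-(Real.pi * √x)) (Real.pi * √x)).indicator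
    (fun u ↦ Complex.exp ((-(x * (1 - Real.cos (u / √x))) : ℝ) : ℂ) *
      Complex.exp (-(ν * ((u / √x : ℝ) : ℂ) * Complex.I))) u with hg
  have hlim : Tendsto (fun x ↦ ∫ u, g x u) atTop (𝓝 (∫ u : ℝ, ((Real.exp (-(1 / 2) * u ^ 2) : ℝ) : ℂ))) := by
    refine tendsto_integral_filter_of_dominated_convergence
      (fun u ↦ Real.exp (-(2 / Real.pi ^ 2) * u ^ 2)) ?_ ?_ (integrable_exp_neg_mul_sq (by positivity)) ?_
    · refine Eventually.of_forall fun x ↦ ?_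
      refine Measurable.aestronglyMeasurable ?_
      refine Measurable.indicator ?_ measurableSet_Ioc
      fun_prop
    · filter_upwards [eventually_gt_atTop 0] with x hx
      refine Eventually.of_forall fun u ↦ ?_
      simp only [hg]
      rw [norm_indicator_eq_indicator_norm]
      refine Set.indicator_le' (g := fun u ↦ Real.exp (-(2 / Real.pi ^ 2) * u ^ 2)) (fun u hu ↦ ?_) (fun u _ ↦ (Real.exp_pos _).le) u
      have h1 : (ν : ℂ) * ((u / √x : ℝ) : ℂ) * Complex.I = ((ν * (u / √x) : ℝ) : ℂ) * Complex.I := by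
        push_cast; ring
      rw [norm_mul, h1, ← neg_mul (((ν * (u / √x) : ℝ) : ℂ)), ← Complex.ofReal_neg, Complex.norm_exp_ofReal_mul_I, mul_one,
        Complex.norm_exp, Complex.ofReal_re]
      refine Real.exp_le_exp.mpr ?_
      have hsx : 0 < √x := Real.sqrt_pos.mpr hx
      have habs : |u / √x| ≤ Real.pi := by
        rw [abs_div, abs_of_pos hsx, div_le_iff₀ hsx]
        exact abs_le.mpr ⟨hu.1.le, hu.2⟩
      have h2 := Real.cos_le_one_sub_mul_cos_sq habs
      have hxx : √x ^ 2 = x := Real.sq_sqrt hx.le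
      rw [div_pow, hxx] at h2
      have h3 : x * (2 / Real.pi ^ 2 * (u ^ 2 / x)) ≤ x * (1 - Real.cos (u / √x)) :=
        mul_le_mul_of_nonneg_left (by linarith) hx.le
      have h4 : x * (2 / Real.pi ^ 2 * (u ^ 2 / x)) = 2 / Real.pi ^ 2 * u ^ 2 := by
        field_simp
      rw [h4] at h3
      linarith
    · refine Eventually.of_forall fun u ↦ ?_
      have hmem : ∀ᶠ x : ℝ in atTop, u ∈ Set.Ioc (-(Real.pi * √x)) (Real.pi * √x) := by
        have h1 : Tendsto (fun x : ℝ ↦ Real.pi * √x) atTop atTop :=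
          Real.tendsto_sqrt_atTop.const_mul_atTop hpi
        filter_upwards [h1.eventually_gt_atTop |u|] with x hx
        exact ⟨(abs_lt.mp hx).1, (abs_lt.mp hx).2.le⟩
      have h1 : Tendsto (fun x : ℝ ↦ Complex.exp ((-(x * (1 - Real.cos (u / √x))) : ℝ) : ℂ) *
          Complex.exp (-(ν * ((u / √x : ℝ) : ℂ) * Complex.I))) atTop
          (𝓝 (Complex.exp ((-(u ^ 2 / 2) : ℝ) : ℂ) * Complex.exp (-(ν * ((0 : ℝ) : ℂ) * Complex.I)))) := by
        refine Tendsto.mul ?_ ?_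
        · exact (Complex.continuous_exp.tendsto _).comp
            ((Complex.continuous_ofReal.tendsto _).comp (tendsto_mul_one_sub_cos_div_sqrt u).neg)
        · have hc : Continuous fun s : ℝ ↦ Complex.exp (-(ν * (s : ℂ) * Complex.I)) := by fun_prop
          exact (hc.tendsto 0).comp ((tendsto_const_nhds (x := u)).div_atTop Real.tendsto_sqrt_atTop)
      have h2 : Complex.exp ((-(u ^ 2 / 2) : ℝ) : ℂ) * Complex.exp (-(ν * ((0 : ℝ) : ℂ) * Complex.I)) =
          ((Real.exp (-(1 / 2) * u ^ 2) : ℝ) : ℂ) := by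
        rw [Complex.ofReal_exp]
        simp
        ring_nf
      rw [h2] at h1
      refine h1.congr' ?_
      filter_upwards [hmem] with x hx
      simp only [hg]
      rw [Set.indicator_of_mem hx]
  rw [integral_complex_ofReal, integral_gaussian, show Real.pi / (1 / 2) = 2 * Real.pi by ring] at hlim
  have hval : ∀ᶠ x : ℝ in atTop, ∫ u, g x u =
      ((2 * Real.pi * besselI ν x * (√x * Real.exp (-x)) : ℝ) : ℂ) := by
    filter_upwards [eventually_gt_atTop 0] with x hx
    have hsx : 0 < √x := Real.sqrt_pos.mpr hx
    simp only [hg]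
    rw [integral_indicator measurableSet_Ioc, ← intervalIntegral.integral_of_le
      (by have := mul_pos hpi hsx; linarith)]
    have h1 := intervalIntegral.integral_comp_div (a := -(Real.pi * √x)) (b := Real.pi * √x)
      (fun θ : ℝ ↦ Complex.exp ((-(x * (1 - Real.cos θ)) : ℝ) : ℂ) *
        Complex.exp (-(ν * (θ : ℂ) * Complex.I))) hsx.ne'
    rw [h1, neg_div, mul_div_cancel_right₀ _ hsx.ne']
    have h2 (θ : ℝ) : Complex.exp ((-(x * (1 - Real.cos θ)) : ℝ) : ℂ) *
        Complex.exp (-(ν * (θ : ℂ) * Complex.I)) = Complex.exp ((-x : ℝ) : ℂ) *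
        (Complex.exp (x * Real.cos θ) * Complex.exp (-(ν * θ * Complex.I))) := by
      rw [← Complex.exp_add, ← Complex.exp_add, ← Complex.exp_add]
      congr 1
      push_cast
      ring
    simp_rw [h2]
    rw [intervalIntegral.integral_const_mul, integral_exp_cos_eq_besselI, ← Complex.ofReal_exp,
      Complex.real_smul]
    push_cast
    ring
  have hre : Tendsto (fun x : ℝ ↦ 2 * Real.pi * besselI ν x * (√x * Real.exp (-x))) atTop
      (𝓝 √(2 * Real.pi)) := by
    have := (Complex.continuous_re.tendsto _).comp (hlim.congr' hval)
    simpa only [Function.comp_def, Complex.ofReal_re] using this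
  have hs2 : √(2 * Real.pi) ≠ 0 := (Real.sqrt_pos.mpr (by positivity)).ne'
  have := hre.div_const √(2 * Real.pi)
  rw [div_self hs2] at this
  refine this.congr fun x ↦ ?_
  rw [Real.sqrt_mul (by positivity) x]
  have h2 : √(2 * Real.pi) * √(2 * Real.pi) = 2 * Real.pi := Real.mul_self_sqrt (by positivity)
  rw [div_eq_iff hs2]
  linear_combination -(besselI ν x * (√x * Real.exp (-x))) * h2

end bessel

section qseries

variable {c : ℕ → ℂ} {s : ℤ} {f : ℂ → ℂ}

lemma norm_exp_two_pi_I_mul_intCast (k : ℤ) (w : ℂ) :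
    ‖Complex.exp (2 * Real.pi * Complex.I * k * w)‖ = Real.exp (-(2 * Real.pi * k * w.im)) := by
  rw [Complex.norm_exp]
  congr 1
  simp

lemma norm_exp_shift (m : ℕ) (s : ℤ) (w : ℂ) :
    ‖Complex.exp (2 * Real.pi * Complex.I * (m + s) * w)‖ =
      Real.exp (-(2 * Real.pi * m * w.im)) * Real.exp (-(2 * Real.pi * s * w.im)) := by
  have := norm_exp_two_pi_I_mul_intCast (m + s) w
  push_cast at this
  rw [this, ← Real.exp_add]
  congr 1
  ring

/-- A shifted `q`-series convergent on the upper half-plane is dominated on horizontal strips. -/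
lemma exists_bound_qSeries
    (hf : ∀ τ : ℂ, 0 < τ.im →
      HasSum (fun m : ℕ ↦ c m * Complex.exp (2 * Real.pi * Complex.I * (m + s) * τ)) (f τ))
    {y₀ y₁ : ℝ} (hy₀ : 0 < y₀) :
    ∃ u : ℕ → ℝ, Summable u ∧ ∀ m (w : ℂ), w ∈ {w : ℂ | y₀ < w.im ∧ w.im < y₁} →
      ‖c m * Complex.exp (2 * Real.pi * Complex.I * (m + s) * w)‖ ≤ u m := by
  have hpi := Real.pi_pos
  refine ⟨fun m ↦ ‖c m‖ * (Real.exp (-(2 * Real.pi * m * y₀)) * Real.exp (2 * Real.pi * |(s : ℝ)| * y₁)),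
    ?_, ?_⟩
  · have h := (hf (Complex.I * y₀) (by simpa using hy₀)).summable.norm
    have h2 := h.mul_right (Real.exp (2 * Real.pi * s * y₀) * Real.exp (2 * Real.pi * |(s : ℝ)| * y₁))
    refine h2.congr fun m ↦ ?_
    rw [norm_mul, norm_exp_shift]
    have : (Complex.I * (y₀ : ℂ)).im = y₀ := by simp
    rw [this, Real.exp_neg (2 * Real.pi * s * y₀)]
    field_simp
  · rintro m w ⟨hw₀, hw₁⟩
    rw [norm_mul, norm_exp_shift]
    have hw : 0 < w.im := hy₀.trans hw₀
    beta_reduce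
    gcongr ‖c m‖ * (?_ * ?_)
    · refine Real.exp_le_exp.mpr (neg_le_neg ?_)
      gcongr
    · refine Real.exp_le_exp.mpr ?_
      have h1 : -(2 * Real.pi * s * w.im) = 2 * Real.pi * (-(s : ℝ)) * w.im := by ring
      rw [h1]
      have h2 : -(s : ℝ) ≤ |(s : ℝ)| := neg_le_abs _
      calc 2 * Real.pi * (-(s : ℝ)) * w.im ≤ 2 * Real.pi * |(s : ℝ)| * w.im := by gcongr
        _ ≤ 2 * Real.pi * |(s : ℝ)| * y₁ := by gcongr

lemma isOpen_imStrip (y₀ y₁ : ℝ) : IsOpen {w : ℂ | y₀ < w.im ∧ w.im < y₁} :=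
  (isOpen_lt continuous_const Complex.continuous_im).inter
    (isOpen_lt Complex.continuous_im continuous_const)

lemma qSeries_eventuallyEq
    (hf : ∀ τ : ℂ, 0 < τ.im →
      HasSum (fun m : ℕ ↦ c m * Complex.exp (2 * Real.pi * Complex.I * (m + s) * τ)) (f τ))
    {τ : ℂ} (hτ : 0 < τ.im) :
    f =ᶠ[nhds τ] fun w ↦ ∑' m : ℕ, c m * Complex.exp (2 * Real.pi * Complex.I * (m + s) * w) := by
  filter_upwards [(isOpen_lt continuous_const Complex.continuous_im).mem_nhds hτ] with w hw
  exact (hf w hw).tsum_eq.symm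

lemma differentiableAt_of_hasSum_qSeries
    (hf : ∀ τ : ℂ, 0 < τ.im →
      HasSum (fun m : ℕ ↦ c m * Complex.exp (2 * Real.pi * Complex.I * (m + s) * τ)) (f τ))
    {τ : ℂ} (hτ : 0 < τ.im) : DifferentiableAt ℂ f τ := by
  obtain ⟨u, hu, hb⟩ := exists_bound_qSeries hf (y₀ := τ.im / 2) (y₁ := 2 * τ.im) (by positivity)
  have h := Complex.differentiableOn_tsum_of_summable_norm hu (fun m ↦ by fun_prop)
    (isOpen_imStrip _ _) hb
  have hmem : τ ∈ {w : ℂ | τ.im / 2 < w.im ∧ w.im < 2 * τ.im} := ⟨by linarith, by linarith⟩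
  exact (h.differentiableAt ((isOpen_imStrip _ _).mem_nhds hmem)).congr_of_eventuallyEq
    (qSeries_eventuallyEq hf hτ)

lemma hasSum_deriv_qSeries
    (hf : ∀ τ : ℂ, 0 < τ.im →
      HasSum (fun m : ℕ ↦ c m * Complex.exp (2 * Real.pi * Complex.I * (m + s) * τ)) (f τ))
    {τ : ℂ} (hτ : 0 < τ.im) :
    HasSum (fun m : ℕ ↦ (2 * Real.pi * Complex.I * (m + s)) * c m *
      Complex.exp (2 * Real.pi * Complex.I * (m + s) * τ)) (deriv f τ) := by
  obtain ⟨u, hu, hb⟩ := exists_bound_qSeries hf (y₀ := τ.im / 2) (y₁ := 2 * τ.im) (by positivity)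
  have hmem : τ ∈ {w : ℂ | τ.im / 2 < w.im ∧ w.im < 2 * τ.im} := ⟨by linarith, by linarith⟩
  have h := Complex.hasSum_deriv_of_summable_norm hu (fun m ↦ by fun_prop)
    (isOpen_imStrip _ _) hb hmem
  rw [(qSeries_eventuallyEq hf hτ).deriv_eq]
  refine h.congr_fun fun m ↦ ?_
  have h1 : HasDerivAt (fun w : ℂ ↦ c m * Complex.exp (2 * Real.pi * Complex.I * (m + s) * w))
      (c m * (Complex.exp (2 * Real.pi * Complex.I * (m + s) * τ) *
        (2 * Real.pi * Complex.I * (m + s) * 1))) τ :=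
    (((hasDerivAt_id τ).const_mul _).cexp).const_mul _
  rw [h1.deriv]
  ring

lemma hasSum_iteratedDeriv_qSeries
    (hf : ∀ τ : ℂ, 0 < τ.im →
      HasSum (fun m : ℕ ↦ c m * Complex.exp (2 * Real.pi * Complex.I * (m + s) * τ)) (f τ)) (n : ℕ) :
    ∀ τ : ℂ, 0 < τ.im → HasSum (fun m : ℕ ↦ (2 * Real.pi * Complex.I * (m + s)) ^ n * c m *
      Complex.exp (2 * Real.pi * Complex.I * (m + s) * τ)) (iteratedDeriv n f τ) := by
  induction n with
  | zero => simpa using hf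
  | succ n ih =>
    intro τ hτ
    rw [iteratedDeriv_succ]
    refine (hasSum_deriv_qSeries ih hτ).congr_fun fun m ↦ ?_
    ring

end qseries

section Bol

lemma DifferentiableOn.differentiableAt_iteratedDeriv {f : ℂ → ℂ} {U : Set ℂ}
    (hf : DifferentiableOn ℂ f U) (hU : IsOpen U) (n : ℕ) {z : ℂ} (hz : z ∈ U) :
    DifferentiableAt ℂ (iteratedDeriv n f) z := by
  rw [iteratedDeriv_eq_iterate]
  exact ((hf.analyticOnNhd hU).iterated_deriv n z hz).differentiableAt

lemma iteratedDeriv_succ_id_mul {h : ℂ → ℂ} {U : Set ℂ} (hh : DifferentiableOn ℂ h U)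
    (hU : IsOpen U) (m : ℕ) {z : ℂ} (hz : z ∈ U) :
    iteratedDeriv (m + 1) (fun w ↦ w * h w) z =
      z * iteratedDeriv (m + 1) h z + (m + 1) * iteratedDeriv m h z := by
  have hd (n : ℕ) {w : ℂ} (hw : w ∈ U) : HasDerivAt (iteratedDeriv n h) (iteratedDeriv (n + 1) h w) w := by
    rw [iteratedDeriv_succ]
    exact (hh.differentiableAt_iteratedDeriv hU n hw).hasDerivAt
  induction m generalizing z with
  | zero =>
    have h0 := hd 0 hz
    simp only [iteratedDeriv_zero] at h0
    rw [zero_add, iteratedDeriv_one, ((hasDerivAt_id' z).fun_mul h0).deriv]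
    simp
    ring
  | succ m ih =>
    have heq : iteratedDeriv (m + 1) (fun w ↦ w * h w) =ᶠ[nhds z]
        fun w ↦ w * iteratedDeriv (m + 1) h w + (m + 1) * iteratedDeriv m h w := by
      filter_upwards [hU.mem_nhds hz] with w hw using ih hw
    rw [iteratedDeriv_succ, heq.deriv_eq,
      (((hasDerivAt_id' z).fun_mul (hd (m + 1) hz)).fun_add ((hd m hz).const_mul ((m : ℂ) + 1))).deriv]
    push_cast
    simp
    ring

lemma im_neg_one_div_pos {τ : ℂ} (hτ : 0 < τ.im) : 0 < (-1 / τ).im := by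
  have := UpperHalfPlane.im_inv_neg_coe_pos ⟨τ, hτ⟩
  simpa [neg_div, inv_neg] using this

/-- **Bol's identity** for the inversion `τ ↦ -1 / τ`. -/
lemma iteratedDeriv_bol {f : ℂ → ℂ} (hf : DifferentiableOn ℂ f {z | 0 < z.im}) (n : ℕ) :
    ∀ τ : ℂ, 0 < τ.im → iteratedDeriv (n + 1) (fun z ↦ z ^ n * f (-1 / z)) τ =
      (τ ^ (n + 2))⁻¹ * iteratedDeriv (n + 1) f (-1 / τ) := by
  have hU : IsOpen {z : ℂ | 0 < z.im} := isOpen_lt continuous_const Complex.continuous_im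
  have hne {τ : ℂ} (hτ : 0 < τ.im) : τ ≠ 0 := fun h ↦ by simp [h] at hτ
  have hinv {τ : ℂ} (hτ : 0 < τ.im) : HasDerivAt (fun z : ℂ ↦ -1 / z) ((τ ^ 2)⁻¹) τ := by
    have := (hasDerivAt_inv (hne hτ)).const_mul (-1)
    simpa [div_eq_mul_inv] using this
  have hcomp (n : ℕ) {τ : ℂ} (hτ : 0 < τ.im) : HasDerivAt (fun z ↦ iteratedDeriv n f (-1 / z))
      (iteratedDeriv (n + 1) f (-1 / τ) * (τ ^ 2)⁻¹) τ := by
    have h1 : HasDerivAt (iteratedDeriv n f) (iteratedDeriv (n + 1) f (-1 / τ)) (-1 / τ) := by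
      rw [iteratedDeriv_succ]
      exact (hf.differentiableAt_iteratedDeriv hU n (im_neg_one_div_pos hτ)).hasDerivAt
    exact h1.comp τ (hinv hτ)
  induction n with
  | zero =>
    intro τ hτ
    have h0 := hcomp 0 hτ
    simp only [iteratedDeriv_zero] at h0
    simp only [pow_zero, one_mul, zero_add]
    rw [iteratedDeriv_one, h0.deriv]
    simp [mul_comm]
  | succ n ih =>
    intro τ hτ
    have hτ0 := hne hτ
    have hh : DifferentiableOn ℂ (fun z ↦ z ^ n * f (-1 / z)) {z | 0 < z.im} := fun z hz ↦ by
      have h0 := hcomp 0 hz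
      simp only [iteratedDeriv_zero] at h0
      exact ((differentiableAt_pow n).mul h0.differentiableAt).differentiableWithinAt
    have hfun : (fun z ↦ z ^ (n + 1) * f (-1 / z)) = fun z ↦ z * (z ^ n * f (-1 / z)) := by
      funext z
      ring
    have heq : iteratedDeriv (n + 1) (fun z ↦ z ^ n * f (-1 / z)) =ᶠ[nhds τ]
        fun τ ↦ (τ ^ (n + 2))⁻¹ * iteratedDeriv (n + 1) f (-1 / τ) := by
      filter_upwards [hU.mem_nhds hτ] with w hw using ih w hw
    have hpow : HasDerivAt (fun z : ℂ ↦ z ^ (n + 2)) ((n + 2) * τ ^ (n + 1)) τ := by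
      simpa using hasDerivAt_pow (n + 2) τ
    have hd := (hpow.fun_inv (pow_ne_zero _ hτ0)).fun_mul (hcomp (n + 1) hτ)
    rw [hfun, iteratedDeriv_succ_id_mul hh hU (n + 1) hτ, iteratedDeriv_succ (n := n + 1), heq.deriv_eq,
      hd.deriv, ih τ hτ]
    push_cast
    field_simp
    ring

end Bol

section EtaDerivative

/-- The thirteenth derivative of `η ^ (-24)`. -/
noncomputable def etaDeriv : ℂ → ℂ := iteratedDeriv 13 fun z ↦ ModularForm.eta z ^ (-24 : ℤ)

lemma hasSum_etaDeriv {τ : ℂ} (hτ : 0 < τ.im) :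
    HasSum (fun m : ℕ ↦ (2 * Real.pi * Complex.I * (m + (-1 : ℤ))) ^ 13 * invEulerCoeff m *
      Complex.exp (2 * Real.pi * Complex.I * (m + (-1 : ℤ)) * τ)) (etaDeriv τ) :=
  hasSum_iteratedDeriv_qSeries (fun _ h ↦ hasSum_eta_zpow h) 13 τ hτ

lemma differentiableOn_eta_zpow :
    DifferentiableOn ℂ (fun z ↦ ModularForm.eta z ^ (-24 : ℤ)) {z | 0 < z.im} := fun _ hz ↦
  (differentiableAt_of_hasSum_qSeries (fun _ h ↦ hasSum_eta_zpow h) hz).differentiableWithinAt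

lemma eta_zpow_neg_one_div {τ : ℂ} (hτ : 0 < τ.im) :
    τ ^ 12 * ModularForm.eta (-1 / τ) ^ (-24 : ℤ) = ModularForm.eta τ ^ (-24 : ℤ) := by
  have h := congrFun ModularForm.discriminant_S_invariant ⟨τ, hτ⟩
  rw [ModularForm.SL_slash_apply, UpperHalfPlane.modular_S_smul] at h
  rw [ModularGroup.denom_S, zpow_neg] at h
  have h2 : ModularForm.eta (-τ)⁻¹ ^ 24 * (τ ^ 12)⁻¹ = ModularForm.eta τ ^ 24 := h
  have hτ0 : τ ≠ 0 := fun h ↦ by simp [h] at hτ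
  rw [show -1 / τ = (-τ)⁻¹ by rw [neg_div, one_div, inv_neg]]
  rw [zpow_neg, zpow_neg, show (24 : ℤ) = ((24 : ℕ) : ℤ) from rfl, zpow_natCast, zpow_natCast, ← h2,
    mul_inv, inv_inv, mul_comm]

lemma etaDeriv_neg_one_div {τ : ℂ} (hτ : 0 < τ.im) : etaDeriv (-1 / τ) = τ ^ 14 * etaDeriv τ := by
  have h := iteratedDeriv_bol differentiableOn_eta_zpow 12 τ hτ
  have heq : (fun z : ℂ ↦ z ^ 12 * ModularForm.eta (-1 / z) ^ (-24 : ℤ)) =ᶠ[nhds τ]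
      fun z ↦ ModularForm.eta z ^ (-24 : ℤ) := by
    filter_upwards [(isOpen_lt continuous_const Complex.continuous_im).mem_nhds hτ] with w hw
    exact eta_zpow_neg_one_div hw
  rw [heq.iteratedDeriv_eq] at h
  have hτ0 : τ ≠ 0 := fun h ↦ by simp [h] at hτ
  rw [etaDeriv, h, mul_inv_cancel_left₀ (pow_ne_zero _ hτ0)]

lemma etaDeriv_add_one {τ : ℂ} (hτ : 0 < τ.im) : etaDeriv (τ + 1) = etaDeriv τ := by
  refine (hasSum_etaDeriv (by simpa using hτ)).unique ((hasSum_etaDeriv hτ).congr_fun fun m ↦ ?_)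
  congr 1
  rw [Complex.exp_eq_exp_iff_exists_int]
  exact ⟨m - 1, by push_cast; ring⟩

end EtaDerivative

section Poincare

open EisensteinSeries UpperHalfPlane MatrixGroups
open scoped Matrix

open Classical in
/-- A matrix in `SL(2, ℤ)` with prescribed coprime bottom row. -/
noncomputable def bottomRowLift (v : Fin 2 → ℤ) : SL(2, ℤ) :=
  if h : IsCoprime (v 0) (v 1) then (h.exists_SL2_row 1).choose else 1

lemma bottomRowLift_spec {v : Fin 2 → ℤ} (h : IsCoprime (v 0) (v 1)) :
    bottomRowLift v 1 0 = v 0 ∧ bottomRowLift v 1 1 = v 1 := by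
  rw [bottomRowLift, dif_pos h]
  exact (h.exists_SL2_row 1).choose_spec

lemma coe_smul_eq_of_bottomRow {g g' : SL(2, ℤ)} (h0 : g' 1 0 = g 1 0) (h1 : g' 1 1 = g 1 1) (τ : ℍ) :
    ∃ k : ℤ, ((g' • τ : ℍ) : ℂ) = ((g • τ : ℍ) : ℂ) + k := by
  have hg := g.det_coe
  have hg' := g'.det_coe
  rw [Matrix.det_fin_two] at hg hg'
  have ha : g' 0 0 = g 0 0 + (g 0 0 * g' 0 1 - g' 0 0 * g 0 1) * g 1 0 := by
    rw [h0, h1] at hg'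
    linear_combination g 0 0 * hg' - g' 0 0 * hg
  have hb : g' 0 1 = g 0 1 + (g 0 0 * g' 0 1 - g' 0 0 * g 0 1) * g 1 1 := by
    rw [h0, h1] at hg'
    linear_combination g 0 1 * hg' - g' 0 1 * hg
  refine ⟨g 0 0 * g' 0 1 - g' 0 0 * g 0 1, ?_⟩
  have hD := denom_ne_zero (g : GL (Fin 2) ℝ) τ
  have hden : ((g 1 0 : ℤ) : ℂ) * (τ : ℂ) + (g 1 1 : ℤ) ≠ 0 := by
    simpa [denom] using hD
  rw [coe_specialLinearGroup_apply, coe_specialLinearGroup_apply]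
  simp only [algebraMap_int_eq, eq_intCast, Complex.ofReal_intCast, h0, h1]
  rw [div_eq_iff hden, add_mul, div_mul_cancel₀ _ hden]
  have haC := congrArg (Int.cast : ℤ → ℂ) ha
  have hbC := congrArg (Int.cast : ℤ → ℂ) hb
  push_cast at haC hbC ⊢
  linear_combination (τ : ℂ) * haC + hbC

open Classical in
/-- The summand `e(-γτ) (cτ + d) ^ (-14)` of the Poincaré series, where `γ` has bottom row `(c, d)`;
it vanishes unless `c` and `d` are coprime. -/
noncomputable def poincareSummand (v : Fin 2 → ℤ) (τ : ℍ) : ℂ :=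
  if IsCoprime (v 0) (v 1) then
    Complex.exp (-(2 * Real.pi * Complex.I * ((bottomRowLift v • τ : ℍ) : ℂ))) * eisSummand 14 v τ
  else 0

lemma poincareSummand_eq {v : Fin 2 → ℤ} {g : SL(2, ℤ)} (h0 : g 1 0 = v 0) (h1 : g 1 1 = v 1)
    (τ : ℍ) : poincareSummand v τ =
      Complex.exp (-(2 * Real.pi * Complex.I * ((g • τ : ℍ) : ℂ))) * eisSummand 14 v τ := by
  have hcop : IsCoprime (v 0) (v 1) := by
    rw [← h0, ← h1]
    have hg := g.det_coe
    rw [Matrix.det_fin_two] at hg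
    exact ⟨-g 0 1, g 0 0, by linear_combination hg⟩
  obtain ⟨hl0, hl1⟩ := bottomRowLift_spec hcop
  obtain ⟨k, hk⟩ := coe_smul_eq_of_bottomRow (g := g) (g' := bottomRowLift v)
    (hl0.trans h0.symm) (hl1.trans h1.symm) τ
  rw [poincareSummand, if_pos hcop, hk]
  congr 1
  rw [Complex.exp_eq_exp_iff_exists_int]
  exact ⟨-k, by push_cast; ring⟩

lemma poincareSummand_of_not_isCoprime {v : Fin 2 → ℤ} (h : ¬ IsCoprime (v 0) (v 1)) (τ : ℍ) :
    poincareSummand v τ = 0 := by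
  rw [poincareSummand, if_neg h]

/-- Right multiplication of integer row vectors by a matrix in `SL(2, ℤ)`. -/
noncomputable def vecMulEquiv (A : SL(2, ℤ)) : (Fin 2 → ℤ) ≃ (Fin 2 → ℤ) where
  toFun v := v ᵥ* (A : Matrix (Fin 2) (Fin 2) ℤ)
  invFun v := v ᵥ* ((A⁻¹ : SL(2, ℤ)) : Matrix (Fin 2) (Fin 2) ℤ)
  left_inv v := by
    simp_rw [Matrix.vecMul_vecMul, ← Matrix.SpecialLinearGroup.coe_mul, mul_inv_cancel,
      Matrix.SpecialLinearGroup.coe_one, Matrix.vecMul_one]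
  right_inv v := by
    simp_rw [Matrix.vecMul_vecMul, ← Matrix.SpecialLinearGroup.coe_mul, inv_mul_cancel,
      Matrix.SpecialLinearGroup.coe_one, Matrix.vecMul_one]

lemma poincareSummand_smul (v : Fin 2 → ℤ) (A : SL(2, ℤ)) (τ : ℍ) :
    poincareSummand v (A • τ) = denom A τ ^ (14 : ℤ) * poincareSummand (vecMulEquiv A v) τ := by
  by_cases h : IsCoprime (v 0) (v 1)
  · obtain ⟨h0, h1⟩ := bottomRowLift_spec h
    have e0 : (bottomRowLift v * A) 1 0 = (vecMulEquiv A v) 0 := by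
      simp [vecMulEquiv, Matrix.vecMul, Matrix.mul_apply, Fin.sum_univ_two, h0, h1,
        Matrix.vec2_dotProduct]
    have e1 : (bottomRowLift v * A) 1 1 = (vecMulEquiv A v) 1 := by
      simp [vecMulEquiv, Matrix.vecMul, Matrix.mul_apply, Fin.sum_univ_two, h0, h1,
        Matrix.vec2_dotProduct]
    rw [poincareSummand_eq h0 h1, poincareSummand_eq e0 e1, eisSummand_SL2_apply, mul_smul]
    simp only [vecMulEquiv, Equiv.coe_fn_mk]
    ring
  · have h' : ¬ IsCoprime ((vecMulEquiv A v) 0) ((vecMulEquiv A v) 1) := fun h' ↦ h (by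
      have := h'.vecMulSL A⁻¹
      rwa [show (vecMulEquiv A v) ᵥ* ((A⁻¹ : SL(2, ℤ)) : Matrix (Fin 2) (Fin 2) ℤ) = v from (vecMulEquiv A).left_inv v] at this)
    rw [poincareSummand_of_not_isCoprime h, poincareSummand_of_not_isCoprime h', mul_zero]

/-- Twice the Poincaré series of weight `14` and level one with principal part `q⁻¹`. -/
noncomputable def poincareSeries (τ : ℍ) : ℂ := ∑' v : Fin 2 → ℤ, poincareSummand v τ

lemma poincareSeries_smul (A : SL(2, ℤ)) (τ : ℍ) :
    poincareSeries (A • τ) = denom A τ ^ (14 : ℤ) * poincareSeries τ := by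
  simp_rw [poincareSeries, poincareSummand_smul, tsum_mul_left]
  rw [(vecMulEquiv A).tsum_eq (fun v ↦ poincareSummand v τ)]

lemma summable_norm_poincareSummand (τ : ℍ) : Summable fun v ↦ ‖poincareSummand v τ‖ := by
  refine Summable.of_nonneg_of_le (fun _ ↦ norm_nonneg _) (fun v ↦ ?_)
    ((summable_norm_eisSummand (k := 14) (by norm_num) τ).mul_left
      (Real.exp (2 * Real.pi * (τ.im / r τ ^ 2))))
  by_cases h : IsCoprime (v 0) (v 1)
  · obtain ⟨h0, h1⟩ := bottomRowLift_spec h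
    rw [poincareSummand, if_pos h, norm_mul, Complex.norm_exp]
    gcongr
    have him : (-(2 * Real.pi * Complex.I * ((bottomRowLift v • τ : ℍ) : ℂ))).re =
        2 * Real.pi * (bottomRowLift v • τ).im := by simp
    rw [him, ModularGroup.im_smul_eq_div_normSq, Complex.normSq_eq_norm_sq]
    have hden : denom (bottomRowLift v) τ = v 0 * (τ : ℂ) + v 1 := by
      simp [denom, h0, h1]
    have hv : v ≠ 0 := by
      rintro rfl
      exact not_isCoprime_zero_zero h
    have hv1 : (1 : ℝ) ≤ ‖v‖ := by
      have hpos := norm_pos_iff.mpr hv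
      rw [norm_eq_max_natAbs] at hpos ⊢
      exact_mod_cast hpos
    have hr := r_pos τ
    have hle : r τ ≤ ‖denom (bottomRowLift v) τ‖ := by
      rw [hden]
      exact (le_mul_of_one_le_right hr.le hv1).trans (r_mul_max_le τ hv)
    have hpi := Real.pi_pos
    have hτ := τ.im_pos
    gcongr
  · rw [poincareSummand_of_not_isCoprime h, norm_zero]
    positivity

end Poincare

section Kernel

/-- The power series `n ^ 13 ∑ⱼ (4π²nx) ^ j / (j! (j + 13)!)`, a rescaled Bessel function. -/
noncomputable def besselKernel (x : ℝ) (n : ℕ) : ℝ :=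
  ∑' j : ℕ, (n : ℝ) ^ 13 * ((4 * Real.pi ^ 2 * n * x) ^ j / ((j.factorial : ℝ) * ((j + 13).factorial : ℝ)))

lemma summable_besselKernel_prod (x : ℝ) (hx : 0 ≤ x) {y : ℝ} (hy : 0 < y) :
    Summable fun p : ℕ × ℕ ↦ (p.1 : ℝ) ^ 13 * ((4 * Real.pi ^ 2 * p.1 * x) ^ p.2 /
      ((p.2.factorial : ℝ) * ((p.2 + 13).factorial : ℝ))) * Real.exp (-(2 * Real.pi * y)) ^ p.1 := by
  have hpi := Real.pi_pos
  set ε : ℝ := Real.pi * y with hε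
  have hε0 : 0 < ε := by positivity
  have h1 : Summable fun n : ℕ ↦ Real.exp (-ε) ^ n :=
    summable_geometric_of_lt_one (Real.exp_pos _).le (Real.exp_lt_one_iff.mpr (by linarith))
  have h2 := (Real.summable_pow_div_factorial (4 * Real.pi ^ 2 * x / ε)).mul_left (ε ^ 13)⁻¹
  have h3 := h1.mul_of_nonneg h2 (fun _ ↦ by positivity) (fun _ ↦ by positivity)
  refine Summable.of_nonneg_of_le (fun p ↦ by positivity) (fun p ↦ ?_) h3
  obtain ⟨n, j⟩ := p
  have h4 := Real.pow_div_factorial_le_exp (ε * n) (by positivity) (j + 13)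
  have h5 : Real.exp (-(2 * Real.pi * y)) ^ n = Real.exp (-(ε * n)) * Real.exp (-ε) ^ n := by
    rw [← Real.exp_nat_mul, ← Real.exp_nat_mul, ← Real.exp_add, hε]
    congr 1
    ring
  have h6 : (n : ℝ) ^ 13 * ((4 * Real.pi ^ 2 * n * x) ^ j /
      ((j.factorial : ℝ) * ((j + 13).factorial : ℝ))) =
      (ε ^ 13)⁻¹ * ((4 * Real.pi ^ 2 * x / ε) ^ j / j.factorial) *
        ((ε * n) ^ (j + 13) / (j + 13).factorial) := by
    have : 4 * Real.pi ^ 2 * n * x = 4 * Real.pi ^ 2 * x / ε * (ε * n) := by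
      field_simp
    rw [this, mul_pow, pow_add, mul_pow ε (n : ℝ) 13]
    field_simp
  simp only
  rw [h6, h5]
  calc (ε ^ 13)⁻¹ * ((4 * Real.pi ^ 2 * x / ε) ^ j / j.factorial) *
        ((ε * n) ^ (j + 13) / (j + 13).factorial) * (Real.exp (-(ε * n)) * Real.exp (-ε) ^ n)
      ≤ (ε ^ 13)⁻¹ * ((4 * Real.pi ^ 2 * x / ε) ^ j / j.factorial) *
        Real.exp (ε * n) * (Real.exp (-(ε * n)) * Real.exp (-ε) ^ n) := by gcongr
    _ = (ε ^ 13)⁻¹ * ((4 * Real.pi ^ 2 * x / ε) ^ j / j.factorial) *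
        (Real.exp (ε * n) * Real.exp (-(ε * n))) * Real.exp (-ε) ^ n := by ring
    _ = Real.exp (-ε) ^ n * ((ε ^ 13)⁻¹ * ((4 * Real.pi ^ 2 * x / ε) ^ j / j.factorial)) := by
        rw [← Real.exp_add, add_neg_cancel, Real.exp_zero]
        ring

lemma summable_besselKernel_term (x : ℝ) (n : ℕ) : Summable fun j : ℕ ↦
    (n : ℝ) ^ 13 * ((4 * Real.pi ^ 2 * n * x) ^ j / ((j.factorial : ℝ) * ((j + 13).factorial : ℝ))) := by
  refine Summable.mul_left _ (Summable.of_norm_bounded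
    (Real.summable_pow_div_factorial |4 * Real.pi ^ 2 * n * x|) fun j ↦ ?_)
  rw [Real.norm_eq_abs, abs_div, abs_pow,
    abs_of_nonneg (a := (j.factorial : ℝ) * ((j + 13).factorial : ℝ)) (by positivity)]
  have h1 : (1 : ℝ) ≤ ((j + 13).factorial : ℝ) := by exact_mod_cast Nat.factorial_pos _
  gcongr
  exact le_mul_of_one_le_right (by positivity) h1

lemma besselKernel_nonneg {x : ℝ} (hx : 0 ≤ x) (n : ℕ) : 0 ≤ besselKernel x n :=
  tsum_nonneg fun _ ↦ by positivity

lemma besselKernel_mono {x x' : ℝ} (hx : 0 ≤ x) (h : x ≤ x') (n : ℕ) :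
    besselKernel x n ≤ besselKernel x' n :=
  (summable_besselKernel_term x n).tsum_le_tsum (fun j ↦ by gcongr) (summable_besselKernel_term x' n)

lemma summable_besselKernel {x : ℝ} (hx : 0 ≤ x) {y : ℝ} (hy : 0 < y) :
    Summable fun n : ℕ ↦ besselKernel x n * Real.exp (-(2 * Real.pi * y)) ^ n := by
  refine (summable_besselKernel_prod x hx hy).prod.congr fun n ↦ ?_
  simp only
  rw [besselKernel, tsum_mul_right]

lemma besselKernel_eq_besselI (k : ℕ) (hk : 0 < k) (n : ℕ) :
    (2 * Real.pi) ^ 14 / (k : ℝ) ^ 14 * besselKernel (1 / (k : ℝ) ^ 2) n =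
      2 * Real.pi * (n : ℝ) ^ (13 / 2 : ℝ) * (1 / k) * besselI 13 (4 * Real.pi / k * √n) := by
  have hk' : (k : ℝ) ≠ 0 := by positivity
  have hs : (n : ℝ) ^ (13 / 2 : ℝ) = √n ^ 13 := by
    rw [Real.sqrt_eq_rpow, ← Real.rpow_natCast, ← Real.rpow_mul (Nat.cast_nonneg n)]
    norm_num
  have hn : (n : ℝ) = √n ^ 2 := (Real.sq_sqrt (Nat.cast_nonneg n)).symm
  rw [besselKernel, besselI, ← tsum_mul_left, ← tsum_mul_left]
  refine tsum_congr fun j ↦ ?_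
  rw [hs]
  have h1 : 4 * Real.pi ^ 2 * n * (1 / (k : ℝ) ^ 2) = (2 * Real.pi / k * √n) ^ 2 := by
    rw [mul_pow, ← hn]
    field_simp
    ring
  have h2 : 4 * Real.pi / k * √n / 2 = 2 * Real.pi / k * √n := by ring
  have h3 : (n : ℝ) ^ 13 = √n ^ 13 * √n ^ 13 := by
    conv_lhs => rw [hn]
    ring
  rw [h1, h2, h3, pow_add, pow_mul, mul_pow _ (√n) 13]
  field_simp

end Kernel

section Lipschitz

open UpperHalfPlane

lemma summable_norm_inv_add_int_pow (z : ℍ) : Summable fun m : ℤ ↦ ‖(((z : ℂ) + m) ^ 14)⁻¹‖ := by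
  have h := (EisensteinSeries.linear_right_summable z 1 (k := 14) (by norm_num)).norm
  refine h.congr fun m ↦ ?_
  norm_num

lemma im_le_norm_add_int (z : ℍ) (m : ℤ) : z.im ≤ ‖(z : ℂ) + m‖ := by
  have h := Complex.abs_im_le_norm ((z : ℂ) + m)
  have h2 : ((z : ℂ) + m).im = z.im := by simp
  rw [h2] at h
  exact (le_abs_self _).trans h

lemma add_int_ne_zero (z : ℍ) (m : ℤ) : (z : ℂ) + m ≠ 0 := by
  have := z.im_pos.trans_le (im_le_norm_add_int z m)
  exact norm_pos_iff.mp this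

lemma norm_exp_eq (z : ℍ) : ‖Complex.exp (2 * Real.pi * Complex.I * z)‖ =
    Real.exp (-(2 * Real.pi * z.im)) := by
  rw [Complex.norm_exp]
  congr 1
  simp

/-- A Lipschitz-type summation formula. -/
lemma tsum_exp_mul_inv_pow (z : ℍ) (x : ℝ) (hx : 0 ≤ x) :
    ∑' m : ℤ, Complex.exp (2 * Real.pi * Complex.I * x / ((z : ℂ) + m)) * (((z : ℂ) + m) ^ 14)⁻¹ =
      ∑' n : ℕ, (-(2 * Real.pi) ^ 14 * besselKernel x n) * Complex.exp (2 * Real.pi * Complex.I * z) ^ n := by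
  set T : ℤ → ℕ → ℂ := fun m j ↦
    (2 * Real.pi * Complex.I * x) ^ j / (j.factorial : ℂ) * (1 / ((z : ℂ) + m) ^ (j + 13 + 1)) with hT
  set q : ℂ := Complex.exp (2 * Real.pi * Complex.I * z) with hq
  have hpi := Real.pi_pos
  have hy := z.im_pos
  have hTsum : Summable (Function.uncurry T) := by
    have h1 := (summable_norm_inv_add_int_pow z).mul_of_nonneg
      (Real.summable_pow_div_factorial (2 * Real.pi * x / z.im)) (fun _ ↦ norm_nonneg _)
      (fun _ ↦ by positivity)
    refine Summable.of_norm_bounded h1 fun p ↦ ?_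
    obtain ⟨m, j⟩ := p
    simp only [hT, Function.uncurry_apply_pair]
    have hle := im_le_norm_add_int z m
    have hpos : 0 < ‖(z : ℂ) + m‖ := hy.trans_le hle
    have h2 : ‖2 * (Real.pi : ℂ) * Complex.I * x‖ = 2 * Real.pi * x := by
      simp [abs_of_pos hpi, abs_of_nonneg hx]
    rw [norm_mul, norm_div, norm_pow, h2, norm_div, norm_one, norm_pow, norm_inv, norm_pow,
      Complex.norm_natCast, div_pow]
    have h3 : (1 : ℝ) / ‖(z : ℂ) + m‖ ^ (j + 13 + 1) ≤ (‖(z : ℂ) + m‖ ^ 14)⁻¹ * (z.im ^ j)⁻¹ := by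
      rw [show j + 13 + 1 = 14 + j by ring, pow_add, one_div, mul_inv]
      gcongr
    calc (2 * Real.pi * x) ^ j / (j.factorial : ℝ) * (1 / ‖(z : ℂ) + m‖ ^ (j + 13 + 1))
        ≤ (2 * Real.pi * x) ^ j / (j.factorial : ℝ) * ((‖(z : ℂ) + m‖ ^ 14)⁻¹ * (z.im ^ j)⁻¹) := by gcongr
      _ = _ := by field_simp
  have hrow (m : ℤ) : Complex.exp (2 * Real.pi * Complex.I * x / ((z : ℂ) + m)) *
      (((z : ℂ) + m) ^ 14)⁻¹ = ∑' j : ℕ, T m j := by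
    have hne := add_int_ne_zero z m
    have h := (hasSum_cexp (2 * Real.pi * Complex.I * x / ((z : ℂ) + m))).mul_right (((z : ℂ) + m) ^ 14)⁻¹
    rw [← h.tsum_eq]
    refine tsum_congr fun j ↦ ?_
    simp only [hT]
    rw [div_pow, show j + 13 + 1 = j + 14 by ring, pow_add _ j 14]
    field_simp
  set V : ℕ → ℕ → ℂ := fun n j ↦ (-(2 * Real.pi) ^ 14 * (((n : ℝ) ^ 13 * ((4 * Real.pi ^ 2 * n * x) ^ j /
      ((j.factorial : ℝ) * ((j + 13).factorial : ℝ))) : ℝ) : ℂ)) * q ^ n with hV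
  have hcol (j : ℕ) : ∑' m : ℤ, T m j = ∑' n : ℕ, V n j := by
    simp only [hT]
    rw [tsum_mul_left, EisensteinSeries.qExpansion_identity (k := j + 13) (by omega) z, ← mul_assoc,
      ← tsum_mul_left]
    refine tsum_congr fun n ↦ ?_
    simp only [hV]
    have hI : (Complex.I) ^ 14 = -1 := by
      rw [show 14 = 2 * 7 by norm_num, pow_mul, Complex.I_sq]
      norm_num
    have hc : (2 * Real.pi * Complex.I * x) ^ j * (-2 * Real.pi * Complex.I) ^ (j + 13 + 1) =
        -(2 * Real.pi) ^ 14 * (4 * Real.pi ^ 2 * x) ^ j := by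
      rw [show j + 13 + 1 = j + 14 by ring, pow_add, ← mul_assoc, ← mul_pow]
      have e1 : 2 * (Real.pi : ℂ) * Complex.I * x * (-2 * Real.pi * Complex.I) = 4 * Real.pi ^ 2 * x := by
        linear_combination (-4 * (Real.pi : ℂ) ^ 2 * x) * Complex.I_sq
      have e2 : (-2 * (Real.pi : ℂ) * Complex.I) ^ 14 = -(2 * Real.pi) ^ 14 := by
        rw [mul_pow, hI]
        ring
      rw [e1, e2]
      ring
    have hf1 : (j.factorial : ℂ) ≠ 0 := by exact_mod_cast j.factorial_ne_zero
    have hf2 : ((j + 13).factorial : ℂ) ≠ 0 := by exact_mod_cast (j + 13).factorial_ne_zero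
    calc (2 * Real.pi * Complex.I * x) ^ j / (j.factorial : ℂ) *
          ((-2 * Real.pi * Complex.I) ^ (j + 13 + 1) / ((j + 13).factorial : ℂ)) *
          ((n : ℂ) ^ (j + 13) * q ^ n)
        = ((2 * Real.pi * Complex.I * x) ^ j * (-2 * Real.pi * Complex.I) ^ (j + 13 + 1)) *
          ((n : ℂ) ^ (j + 13) * q ^ n) / ((j.factorial : ℂ) * ((j + 13).factorial : ℂ)) := by
            field_simp
      _ = _ := by
          rw [hc]
          push_cast
          rw [show (4 * (Real.pi : ℂ) ^ 2 * n * x) = 4 * (Real.pi : ℂ) ^ 2 * x * n by ring,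
            mul_pow (4 * (Real.pi : ℂ) ^ 2 * x) (n : ℂ) j, pow_add]
          field_simp
  have hVsum : Summable (Function.uncurry V) := by
    have h1 := (summable_besselKernel_prod x hx hy).mul_left ((2 * Real.pi) ^ 14)
    refine Summable.of_norm_bounded h1 fun p ↦ le_of_eq ?_
    obtain ⟨n, j⟩ := p
    simp only [hV, Function.uncurry_apply_pair]
    rw [norm_mul, norm_mul, norm_pow, hq, norm_exp_eq, Complex.norm_real, Real.norm_eq_abs,
      abs_of_nonneg (a := _ * _) (by positivity), norm_neg, norm_pow]
    have : ‖2 * (Real.pi : ℂ)‖ = 2 * Real.pi := by simp [abs_of_pos hpi]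
    rw [this]
    ring
  calc _ = ∑' m : ℤ, ∑' j : ℕ, T m j := tsum_congr hrow
    _ = ∑' j : ℕ, ∑' m : ℤ, T m j := hTsum.tsum_comm.symm
    _ = ∑' j : ℕ, ∑' n : ℕ, V n j := tsum_congr hcol
    _ = ∑' n : ℕ, ∑' j : ℕ, V n j := hVsum.tsum_comm
    _ = _ := by
        refine tsum_congr fun n ↦ ?_
        simp only [hV]
        rw [tsum_mul_right, tsum_mul_left, besselKernel, Complex.ofReal_tsum]

end Lipschitz

section PoincareFourier

open UpperHalfPlane EisensteinSeries MatrixGroups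

lemma norm_dedekindOmega (h k : ℕ) : ‖dedekindOmega h k‖ = 1 := by
  have : (Real.pi * Complex.I * dedekindSum h k : ℂ) = ((Real.pi * dedekindSum h k : ℝ) : ℂ) * Complex.I := by
    push_cast
    ring
  rw [dedekindOmega, this, Complex.norm_exp_ofReal_mul_I]

lemma norm_exp_neg_two_pi_I_div (n h k : ℕ) :
    ‖Complex.exp (-(2 * Real.pi * Complex.I * ((n : ℂ) + 1) * h / (k : ℂ)))‖ = 1 := by
  have : (-(2 * Real.pi * Complex.I * ((n : ℂ) + 1) * h / (k : ℂ))) =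
      ((-(2 * Real.pi * (n + 1) * h / k) : ℝ) : ℂ) * Complex.I := by
    push_cast
    ring
  rw [this, Complex.norm_exp_ofReal_mul_I]

lemma norm_rademacherTerm_le (n : ℕ) (k : ℕ+) :
    ‖rademacherTerm n k‖ ≤ besselI 13 (4 * Real.pi / (k : ℕ) * √n) := by
  have hk : (0 : ℝ) < (k : ℕ) := by exact_mod_cast k.pos
  have hI : 0 ≤ besselI 13 (4 * Real.pi / (k : ℕ) * √n) := tsum_nonneg fun m ↦ by positivity
  rw [rademacherTerm, norm_mul, norm_div, norm_one, Complex.norm_natCast]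
  have h1 : ‖∑ h ∈ (Finset.range (k : ℕ)).filter (fun h => Nat.gcd h k = 1),
      dedekindOmega h k ^ 24 *
      Complex.exp (-(2 * Real.pi * Complex.I * ((n : ℂ) + 1) * h / ((k : ℕ) : ℂ))) *
      (besselI 13 (4 * Real.pi / ((k : ℕ) : ℝ) * Real.sqrt n) : ℂ)‖ ≤
      (k : ℕ) * besselI 13 (4 * Real.pi / (k : ℕ) * √n) := by
    refine (norm_sum_le_of_le _ fun h _ ↦ ?_).trans (b := ∑ _h ∈ (Finset.range (k : ℕ)).filter
      (fun h => Nat.gcd h k = 1), besselI 13 (4 * Real.pi / (k : ℕ) * √n)) ?_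
    · rw [norm_mul, norm_mul, norm_pow, norm_dedekindOmega, norm_exp_neg_two_pi_I_div, one_pow, one_mul,
        one_mul, Complex.norm_real, Real.norm_eq_abs, abs_of_nonneg hI]
    · rw [Finset.sum_const, nsmul_eq_mul]
      gcongr
      exact (Finset.card_filter_le _ _).trans (by simp)
  calc 1 / ((k : ℕ) : ℝ) * _ ≤ 1 / ((k : ℕ) : ℝ) *
        ((k : ℕ) * besselI 13 (4 * Real.pi / (k : ℕ) * √n)) := by gcongr
    _ = _ := by field_simp

/-- The `q`-coefficient contributed to the Poincaré series by the lower left entry `k`. -/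
noncomputable def poincareCoeffTerm (n : ℕ) (k : ℕ+) : ℂ :=
  -((2 * Real.pi * (n : ℝ) ^ (13 / 2 : ℝ) : ℝ) : ℂ) * rademacherTerm n k

lemma norm_poincareCoeffTerm_le (n : ℕ) (k : ℕ+) :
    ‖poincareCoeffTerm n k‖ ≤ (1 / ((k : ℕ) : ℝ) ^ 13) * ((2 * Real.pi) ^ 14 * besselKernel 1 n) := by
  have hk : (0 : ℝ) < (k : ℕ) := by exact_mod_cast k.pos
  have hk1 : (1 : ℝ) ≤ (k : ℕ) := by exact_mod_cast Nat.succ_le_of_lt k.pos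
  have hpi := Real.pi_pos
  rw [poincareCoeffTerm, norm_mul, norm_neg, Complex.norm_real, Real.norm_eq_abs,
    abs_of_nonneg (by positivity)]
  have h1 := besselKernel_eq_besselI k k.pos n
  have h2 : besselKernel (1 / ((k : ℕ) : ℝ) ^ 2) n ≤ besselKernel 1 n := by
    refine besselKernel_mono (by positivity) ?_ n
    rw [div_le_one (by positivity)]
    exact one_le_pow₀ hk1
  calc 2 * Real.pi * (n : ℝ) ^ (13 / 2 : ℝ) * ‖rademacherTerm n k‖
      ≤ 2 * Real.pi * (n : ℝ) ^ (13 / 2 : ℝ) * besselI 13 (4 * Real.pi / (k : ℕ) * √n) := by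
        gcongr
        exact norm_rademacherTerm_le n k
    _ = (k : ℕ) * (2 * Real.pi * (n : ℝ) ^ (13 / 2 : ℝ) * (1 / (k : ℕ)) *
          besselI 13 (4 * Real.pi / (k : ℕ) * √n)) := by field_simp
    _ = (k : ℕ) * ((2 * Real.pi) ^ 14 / ((k : ℕ) : ℝ) ^ 14 * besselKernel (1 / ((k : ℕ) : ℝ) ^ 2) n) := by
        rw [h1]
    _ = 1 / ((k : ℕ) : ℝ) ^ 13 * ((2 * Real.pi) ^ 14 * besselKernel (1 / ((k : ℕ) : ℝ) ^ 2) n) := by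
        field_simp
    _ ≤ _ := by gcongr

lemma summable_one_div_pnat_pow : Summable fun k : ℕ+ ↦ 1 / ((k : ℕ) : ℝ) ^ 13 :=
  (Real.summable_one_div_nat_pow.mpr (by norm_num)).comp_injective PNat.coe_injective

lemma summable_rademacherTerm (n : ℕ) : Summable (rademacherTerm n) := by
  have hpi := Real.pi_pos
  refine Summable.of_norm_bounded
    (summable_one_div_pnat_pow.mul_right (besselI 13 (4 * Real.pi * √n))) fun k ↦ ?_
  refine (norm_rademacherTerm_le n k).trans ?_
  have hk1 : (1 : ℝ) ≤ (k : ℕ) := by exact_mod_cast Nat.succ_le_of_lt k.pos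
  have h := besselI_mul_le 13 (t := 1 / ((k : ℕ) : ℝ)) (x := 4 * Real.pi * √n) (by positivity)
    ((div_le_one (by positivity)).mpr hk1) (by positivity)
  rw [one_div_pow] at h
  refine le_trans (le_of_eq ?_) h
  congr 1
  ring

lemma isCoprime_natCast_mul_sub_iff (k h : ℕ) (m : ℤ) :
    IsCoprime (k : ℤ) (m * k - h) ↔ Nat.gcd h k = 1 := by
  rw [show m * (k : ℤ) - h = -h + k * m by ring, IsCoprime.add_mul_left_right_iff,
    IsCoprime.neg_right_iff, Nat.isCoprime_iff_coprime, Nat.coprime_comm, Nat.Coprime]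

lemma poincareSummand_eq_of_coprime {h : ℕ} {k : ℕ+} (hc : Nat.gcd h k = 1) (m : ℤ) (τ : ℍ) :
    poincareSummand ![((k : ℕ) : ℤ), m * (k : ℕ) - h] τ =
      dedekindOmega h k ^ 24 * Complex.exp (-(2 * Real.pi * Complex.I * h / (k : ℕ))) *
        (((k : ℕ) : ℂ) ^ 14)⁻¹ *
        (Complex.exp (2 * Real.pi * Complex.I * ((1 / ((k : ℕ) : ℝ) ^ 2 : ℝ) : ℂ) /
          ((((-(h / (k : ℕ)) : ℝ) +ᵥ τ : ℍ) : ℂ) + m)) *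
          (((((-(h / (k : ℕ)) : ℝ) +ᵥ τ : ℍ) : ℂ) + m) ^ 14)⁻¹) := by
  have hkC : ((k : ℕ) : ℂ) ≠ 0 := by exact_mod_cast k.pos.ne'
  obtain ⟨u, h', huh⟩ : IsCoprime ((k : ℕ) : ℤ) (h : ℤ) := by
    rw [Nat.isCoprime_iff_coprime, Nat.coprime_comm]
    exact hc
  have hdvd : ((k : ℕ) : ℤ) ∣ h * h' - 1 := ⟨-u, by linear_combination huh⟩
  let g : SL(2, ℤ) := ⟨!![-h', -u - h' * m; ((k : ℕ) : ℤ), m * (k : ℕ) - h], by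
    rw [Matrix.det_fin_two_of]
    linear_combination huh⟩
  have hz := add_int_ne_zero ((-(h / (k : ℕ)) : ℝ) +ᵥ τ) m
  have hzeq : (((-(h / (k : ℕ)) : ℝ) +ᵥ τ : ℍ) : ℂ) = (τ : ℂ) - h / (k : ℕ) := by
    rw [coe_vadd]
    push_cast
    ring
  rw [poincareSummand_eq (g := g) (by simp [g]) (by simp [g]), dedekindOmega_pow k.pos hc hdvd]
  rw [hzeq] at hz ⊢
  set w : ℂ := (τ : ℂ) - h / (k : ℕ) + m with hw
  have hkw : ((k : ℕ) : ℂ) * τ + (m * (k : ℕ) - h) = (k : ℕ) * w := by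
    rw [hw]
    field_simp
    ring
  have hsmul : ((g • τ : ℍ) : ℂ) = -h' / (k : ℕ) - 1 / (((k : ℕ) : ℂ) ^ 2 * w) := by
    rw [coe_specialLinearGroup_apply]
    have huC : (u : ℂ) * (k : ℕ) + h' * h = 1 := by exact_mod_cast huh
    simp only [g, Matrix.of_apply, Matrix.cons_val', Matrix.cons_val_zero,
      Matrix.cons_val_one, Matrix.cons_val_fin_one, algebraMap_int_eq, eq_intCast, Complex.ofReal_intCast]
    push_cast
    rw [hkw]
    have hτ : (τ : ℂ) = w + h / (k : ℕ) - m := by rw [hw]; ring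
    rw [hτ]
    field_simp
    linear_combination -huC
  have heis : eisSummand 14 ![((k : ℕ) : ℤ), m * (k : ℕ) - h] τ =
      (((k : ℕ) : ℂ) ^ 14)⁻¹ * (w ^ 14)⁻¹ := by
    rw [eisSummand, zpow_neg, ← mul_inv, ← mul_pow, ← hkw]
    simp
  have hexp : Complex.exp (-(2 * Real.pi * Complex.I * (-h' / (k : ℕ) - 1 / (((k : ℕ) : ℂ) ^ 2 * w)))) =
      Complex.exp (2 * Real.pi * Complex.I * (h + h') / (k : ℕ)) *
        Complex.exp (-(2 * Real.pi * Complex.I * h / (k : ℕ))) *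
        Complex.exp (2 * Real.pi * Complex.I * ((1 / ((k : ℕ) : ℝ) ^ 2 : ℝ) : ℂ) / w) := by
    rw [← Complex.exp_add, ← Complex.exp_add]
    congr 1
    push_cast
    field_simp
    ring
  rw [hsmul, heis, hexp]
  ring

lemma summable_poincareSummand_row (c : ℤ) (τ : ℍ) :
    Summable fun d : ℤ ↦ poincareSummand ![c, d] τ := by
  have hinj : Function.Injective fun d : ℤ ↦ (![c, d] : Fin 2 → ℤ) := fun a b h ↦ by
    simpa using congrFun h 1
  exact (summable_norm_poincareSummand τ).of_norm.comp_injective hinj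

lemma tsum_poincareSummand_row (k : ℕ+) (τ : ℍ) :
    ∑' d : ℤ, poincareSummand ![((k : ℕ) : ℤ), d] τ =
      ∑ h ∈ (Finset.range (k : ℕ)).filter (fun h => Nat.gcd h k = 1),
        ∑' m : ℤ, poincareSummand ![((k : ℕ) : ℤ), m * (k : ℕ) - h] τ := by
  let e : Fin (k : ℕ) × ℤ ≃ ℤ :=
    (Equiv.prodComm _ _).trans ((Int.divModEquiv (k : ℕ)).symm.trans (Equiv.neg ℤ))
  have he (p : Fin (k : ℕ) × ℤ) : e p = -(p.2 * (k : ℕ) + (p.1 : ℕ)) := by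
    simp [e]
  have hs : Summable fun p : Fin (k : ℕ) × ℤ ↦ poincareSummand ![((k : ℕ) : ℤ), e p] τ :=
    (summable_poincareSummand_row (k : ℕ) τ).comp_injective e.injective
  rw [← e.tsum_eq, hs.tsum_prod, tsum_fintype]
  rw [Finset.sum_filter, Finset.sum_range]
  refine Finset.sum_congr rfl fun h _ ↦ ?_
  rw [← (Equiv.neg ℤ).tsum_eq]
  have hrow (m : ℤ) : e (h, (Equiv.neg ℤ) m) = m * (k : ℕ) - (h : ℕ) := by
    rw [he, Equiv.neg_apply]
    ring
  simp_rw [hrow]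
  split_ifs with hc
  · rfl
  · refine (tsum_congr fun m ↦ poincareSummand_of_not_isCoprime ?_ τ).trans tsum_zero
    exact fun hcop ↦ hc ((isCoprime_natCast_mul_sub_iff k h m).mp hcop)

lemma summable_mul_exp_pow_of_norm_le {a : ℕ → ℂ} {C : ℝ} (ha : ∀ n, ‖a n‖ ≤ C * besselKernel 1 n) (τ : ℍ) :
    Summable fun n : ℕ ↦ a n * Complex.exp (2 * Real.pi * Complex.I * τ) ^ n := by
  refine Summable.of_norm_bounded ((summable_besselKernel zero_le_one τ.im_pos).mul_left C) fun n ↦ ?_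
  rw [norm_mul, norm_pow, norm_exp_eq, ← mul_assoc]
  gcongr
  exact ha n

lemma tsum_poincareSummand_row_eq (k : ℕ+) (τ : ℍ) :
    ∑' d : ℤ, poincareSummand ![((k : ℕ) : ℤ), d] τ =
      ∑' n : ℕ, poincareCoeffTerm n k * Complex.exp (2 * Real.pi * Complex.I * τ) ^ n := by
  have hpi := Real.pi_pos
  have hk : (0 : ℝ) < (k : ℕ) := by exact_mod_cast k.pos
  have hk1 : (1 : ℝ) ≤ (k : ℕ) := by exact_mod_cast Nat.succ_le_of_lt k.pos
  have hkC : ((k : ℕ) : ℂ) ≠ 0 := by exact_mod_cast k.pos.ne'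
  have hx1 : 1 / ((k : ℕ) : ℝ) ^ 2 ≤ 1 := by
    rw [div_le_one (by positivity)]
    exact one_le_pow₀ hk1
  rw [tsum_poincareSummand_row]
  have hrow : ∀ h ∈ (Finset.range (k : ℕ)).filter (fun h => Nat.gcd h k = 1),
      ∑' m : ℤ, poincareSummand ![((k : ℕ) : ℤ), m * (k : ℕ) - h] τ =
      ∑' n : ℕ, dedekindOmega h k ^ 24 * Complex.exp (-(2 * Real.pi * Complex.I * h / (k : ℕ))) *
        (((k : ℕ) : ℂ) ^ 14)⁻¹ * ((-(2 * Real.pi) ^ 14 * besselKernel (1 / ((k : ℕ) : ℝ) ^ 2) n) *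
        Complex.exp (2 * Real.pi * Complex.I * ((-(h / (k : ℕ)) : ℝ) +ᵥ τ : ℍ)) ^ n) := by
    intro h hh
    rw [tsum_mul_left, ← tsum_exp_mul_inv_pow _ _ (by positivity), ← tsum_mul_left]
    exact tsum_congr fun m ↦ poincareSummand_eq_of_coprime (Finset.mem_filter.mp hh).2 m τ
  have hsum (h : ℕ) : Summable fun n : ℕ ↦
      dedekindOmega h k ^ 24 * Complex.exp (-(2 * Real.pi * Complex.I * h / (k : ℕ))) *
        (((k : ℕ) : ℂ) ^ 14)⁻¹ * ((-(2 * Real.pi) ^ 14 * besselKernel (1 / ((k : ℕ) : ℝ) ^ 2) n) *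
        Complex.exp (2 * Real.pi * Complex.I * ((-(h / (k : ℕ)) : ℝ) +ᵥ τ : ℍ)) ^ n) := by
    refine Summable.mul_left _ (summable_mul_exp_pow_of_norm_le (C := (2 * Real.pi) ^ 14) (fun n ↦ ?_) _)
    have : ‖2 * (Real.pi : ℂ)‖ = 2 * Real.pi := by simp [abs_of_pos hpi]
    rw [norm_mul, norm_neg, norm_pow, this, Complex.norm_real, Real.norm_eq_abs,
      abs_of_nonneg (besselKernel_nonneg (by positivity) n)]
    gcongr
    exact besselKernel_mono (by positivity) hx1 n
  rw [Finset.sum_congr rfl hrow, ← Summable.tsum_finsetSum fun h _ ↦ hsum h]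
  refine tsum_congr fun n ↦ ?_
  have hB := congrArg (Complex.ofReal) (besselKernel_eq_besselI k k.pos n)
  rw [poincareCoeffTerm, rademacherTerm, ← mul_assoc, Finset.mul_sum, Finset.sum_mul]
  refine Finset.sum_congr rfl fun h _ ↦ ?_
  have hexp : Complex.exp (2 * Real.pi * Complex.I * ((-(h / (k : ℕ)) : ℝ) +ᵥ τ : ℍ)) ^ n =
      Complex.exp (-(2 * Real.pi * Complex.I * n * h / (k : ℕ))) *
        Complex.exp (2 * Real.pi * Complex.I * τ) ^ n := by
    rw [← Complex.exp_nat_mul, ← Complex.exp_nat_mul, ← Complex.exp_add, coe_vadd]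
    congr 1
    push_cast
    ring
  have hexp2 : Complex.exp (-(2 * Real.pi * Complex.I * ((n : ℂ) + 1) * h / ((k : ℕ) : ℂ))) =
      Complex.exp (-(2 * Real.pi * Complex.I * h / (k : ℕ))) *
      Complex.exp (-(2 * Real.pi * Complex.I * n * h / (k : ℕ))) := by
    rw [← Complex.exp_add]
    congr 1
    ring
  rw [hexp, hexp2]
  push_cast at hB ⊢
  linear_combination (-(dedekindOmega h k ^ 24 * Complex.exp (-(2 * Real.pi * Complex.I * h / (k : ℕ))) *
    Complex.exp (-(2 * Real.pi * Complex.I * n * h / (k : ℕ))) *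
    Complex.exp (2 * Real.pi * Complex.I * τ) ^ n)) * hB

end PoincareFourier

section PoincareExpansion

open UpperHalfPlane EisensteinSeries MatrixGroups

lemma poincareSummand_neg (v : Fin 2 → ℤ) (τ : ℍ) : poincareSummand (-v) τ = poincareSummand v τ := by
  have h := poincareSummand_smul v (-1) τ
  have h1 : ((-1 : SL(2, ℤ)) • τ) = τ := by
    rw [ModularGroup.SL_neg_smul, one_smul]
  have h2 : vecMulEquiv (-1) v = -v := by
    simp [vecMulEquiv, Matrix.vecMul_neg]
  have h3 : denom (-1 : SL(2, ℤ)) τ = -1 := by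
    simp [denom]
  rw [h1, h2, h3] at h
  rw [h]
  norm_num

lemma poincareSummand_zero_one (τ : ℍ) :
    poincareSummand ![0, 1] τ = Complex.exp (-(2 * Real.pi * Complex.I * τ)) := by
  rw [poincareSummand_eq (g := 1) (by simp) (by simp), one_smul]
  simp [eisSummand]

lemma tsum_poincareSummand_zero (τ : ℍ) :
    ∑' d : ℤ, poincareSummand ![0, d] τ = 2 * Complex.exp (-(2 * Real.pi * Complex.I * τ)) := by
  rw [tsum_eq_sum (s := {1, -1})]
  · have hneg : (![0, -1] : Fin 2 → ℤ) = -![0, 1] := by simp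
    rw [Finset.sum_pair (by norm_num), hneg, poincareSummand_neg, poincareSummand_zero_one]
    ring
  · intro d hd
    refine poincareSummand_of_not_isCoprime (fun h ↦ hd ?_) τ
    have h' : IsCoprime (0 : ℤ) d := h
    rw [isCoprime_zero_left, Int.isUnit_iff] at h'
    simpa using h'

/-- The `q`-coefficients of (half of) the Poincaré series. -/
noncomputable def poincareCoeff (n : ℕ) : ℂ := ∑' k : ℕ+, poincareCoeffTerm n k

lemma summable_poincareCoeff_prod (τ : ℍ) : Summable (Function.uncurry fun (k : ℕ+) (n : ℕ) ↦
    poincareCoeffTerm n k * Complex.exp (2 * Real.pi * Complex.I * τ) ^ n) := by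
  have h := summable_one_div_pnat_pow.mul_of_nonneg
    ((summable_besselKernel zero_le_one τ.im_pos).mul_left ((2 * Real.pi) ^ 14))
    (fun _ ↦ by positivity)
    (fun n ↦ by have := besselKernel_nonneg zero_le_one n; positivity)
  refine Summable.of_norm_bounded h fun p ↦ ?_
  obtain ⟨k, n⟩ := p
  simp only [Function.uncurry_apply_pair]
  rw [norm_mul, norm_pow, norm_exp_eq, ← mul_assoc, ← mul_assoc]
  gcongr
  rw [mul_assoc]
  exact norm_poincareCoeffTerm_le n k

/-- The Fourier expansion of the Poincaré series. -/
lemma hasSum_poincareCoeff (τ : ℍ) :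
    HasSum (fun n : ℕ ↦ poincareCoeff n * Complex.exp (2 * Real.pi * Complex.I * τ) ^ n)
      (poincareSeries τ / 2 - Complex.exp (-(2 * Real.pi * Complex.I * τ))) := by
  have hprod : Summable fun p : ℤ × ℤ ↦ poincareSummand ![p.1, p.2] τ := by
    have := (summable_norm_poincareSummand τ).of_norm.comp_injective (finTwoArrowEquiv ℤ).symm.injective
    refine this.congr fun p ↦ ?_
    rw [Function.comp, finTwoArrowEquiv_symm_apply]
  have heven : Function.Even fun c : ℤ ↦ ∑' d : ℤ, poincareSummand ![c, d] τ := by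
    intro c
    beta_reduce
    rw [← (Equiv.neg ℤ).tsum_eq]
    refine tsum_congr fun d ↦ ?_
    rw [← poincareSummand_neg]
    simp
  have hser : poincareSeries τ = ∑' d : ℤ, poincareSummand ![0, d] τ +
      2 • ∑' k : ℕ+, ∑' d : ℤ, poincareSummand ![((k : ℕ) : ℤ), d] τ := by
    rw [poincareSeries, ← (finTwoArrowEquiv ℤ).symm.tsum_eq]
    simp only [finTwoArrowEquiv_symm_apply]
    rw [hprod.tsum_prod]
    exact tsum_int_eq_zero_add_two_mul_tsum_pnat heven hprod.prod
  have hs := summable_poincareCoeff_prod τ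
  have hval : poincareSeries τ / 2 - Complex.exp (-(2 * Real.pi * Complex.I * τ)) =
      ∑' n : ℕ, poincareCoeff n * Complex.exp (2 * Real.pi * Complex.I * τ) ^ n := by
    rw [hser, tsum_poincareSummand_zero]
    simp_rw [tsum_poincareSummand_row_eq, poincareCoeff, ← tsum_mul_right]
    rw [hs.tsum_comm, nsmul_eq_mul]
    push_cast
    ring
  rw [hval]
  refine Summable.hasSum (hs.prod_symm.prod.congr fun n ↦ ?_)
  simp only [Prod.swap_prod_mk, Function.uncurry_apply_pair]
  rw [poincareCoeff, tsum_mul_right]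

lemma poincareCoeff_eq (n : ℕ) : poincareCoeff n =
    -((2 * Real.pi * (n : ℝ) ^ (13 / 2 : ℝ) : ℝ) : ℂ) * ∑' k : ℕ+, rademacherTerm n k := by
  rw [poincareCoeff, ← tsum_mul_left]
  rfl

lemma poincareCoeff_zero : poincareCoeff 0 = 0 := by
  rw [poincareCoeff_eq]
  simp

end PoincareExpansion

section CuspForm

open UpperHalfPlane MatrixGroups ModularForm SlashInvariantForm
open scoped Manifold

/-- The difference of the normalized thirteenth derivative of `η ^ (-24)` and the Poincaré series
cancelling its principal part. -/
noncomputable def etaPoincare (τ : ℍ) : ℂ :=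
  ((2 * Real.pi * Complex.I) ^ 13)⁻¹ * etaDeriv τ + poincareSeries τ / 2

lemma hasSum_etaPoincare (τ : ℍ) :
    HasSum (fun n : ℕ ↦ ((n : ℂ) ^ 13 * invEulerCoeff (n + 1) + poincareCoeff n) *
      Complex.exp (2 * Real.pi * Complex.I * τ) ^ n) (etaPoincare τ) := by
  have h2pi : (2 * Real.pi * Complex.I : ℂ) ≠ 0 := Complex.two_pi_I_ne_zero
  have h1 := (hasSum_etaDeriv τ.im_pos).mul_left (((2 * Real.pi * Complex.I) ^ 13)⁻¹)
  rw [← hasSum_nat_add_iff' 1] at h1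
  have h2 := h1.add (hasSum_poincareCoeff τ)
  have hval : etaPoincare τ = ((2 * Real.pi * Complex.I) ^ 13)⁻¹ * etaDeriv τ -
      ∑ m ∈ Finset.range 1, ((2 * Real.pi * Complex.I) ^ 13)⁻¹ *
        ((2 * Real.pi * Complex.I * (m + (-1 : ℤ))) ^ 13 * invEulerCoeff m *
          Complex.exp (2 * Real.pi * Complex.I * (m + (-1 : ℤ)) * τ)) +
      (poincareSeries τ / 2 - Complex.exp (-(2 * Real.pi * Complex.I * τ))) := by
    have hexp : Complex.exp (2 * Real.pi * Complex.I * (((0 : ℕ) : ℂ) + ((-1 : ℤ) : ℂ)) * τ) =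
        Complex.exp (-(2 * Real.pi * Complex.I * τ)) := by
      congr 1
      push_cast
      ring
    rw [Finset.sum_range_one, hexp, invEulerCoeff_zero, etaPoincare,
      mul_pow (2 * Real.pi * Complex.I) (((0 : ℕ) : ℂ) + _)]
    have : ((2 * Real.pi * Complex.I : ℂ) ^ 13)⁻¹ * (2 * Real.pi * Complex.I) ^ 13 = 1 :=
      inv_mul_cancel₀ (pow_ne_zero _ h2pi)
    push_cast
    linear_combination (-Complex.exp (-(2 * Real.pi * Complex.I * τ))) * this
  rw [hval]
  refine h2.congr_fun fun n ↦ ?_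
  have hexp : Complex.exp (2 * Real.pi * Complex.I * (((n + 1 : ℕ) : ℂ) + ((-1 : ℤ) : ℂ)) * τ) =
      Complex.exp (2 * Real.pi * Complex.I * τ) ^ n := by
    rw [← Complex.exp_nat_mul]
    congr 1
    push_cast
    ring
  rw [hexp, show (((n + 1 : ℕ) : ℂ) + ((-1 : ℤ) : ℂ)) = n by push_cast; ring,
    mul_pow (2 * Real.pi * Complex.I) (n : ℂ)]
  have : ((2 * Real.pi * Complex.I : ℂ) ^ 13)⁻¹ * (2 * Real.pi * Complex.I) ^ 13 = 1 :=
    inv_mul_cancel₀ (pow_ne_zero _ h2pi)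
  linear_combination (-((n : ℂ) ^ 13 * invEulerCoeff (n + 1) *
    Complex.exp (2 * Real.pi * Complex.I * τ) ^ n)) * this

lemma qParam_one_eq (τ : ℂ) : Function.Periodic.qParam 1 τ = Complex.exp (2 * Real.pi * Complex.I * τ) := by
  simp [Function.Periodic.qParam]

lemma etaPoincare_isZeroAtImInfty : IsZeroAtImInfty etaPoincare := by
  set F : ℍ → ℂ := fun τ ↦ etaPoincare τ / Function.Periodic.qParam 1 τ with hF
  have hq (τ : ℍ) : Function.Periodic.qParam 1 τ ≠ 0 := Function.Periodic.qParam_ne_zero _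
  have hsum (τ : ℍ) : HasSum (fun n : ℕ ↦ (((n + 1 : ℕ) : ℂ) ^ 13 * invEulerCoeff (n + 1 + 1) +
      poincareCoeff (n + 1)) • Function.Periodic.qParam 1 τ ^ n) (F τ) := by
    have h := hasSum_etaPoincare τ
    rw [← hasSum_nat_add_iff' 1] at h
    simp only [Finset.sum_range_one, poincareCoeff_zero, ← qParam_one_eq] at h
    norm_num at h
    refine (h.div_const (Function.Periodic.qParam 1 τ)).congr_fun fun n ↦ ?_
    rw [pow_succ, smul_eq_mul]
    push_cast
    field_simp [hq τ]
    ring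
  have hb := isBoundedAtImInfty_of_hasSum_qExpansion one_pos hsum
  have h0 := qParam_tendsto_atImInfty one_pos
  have h1 : etaPoincare = fun τ : ℍ ↦ Function.Periodic.qParam 1 τ * F τ := by
    funext τ
    rw [hF, mul_div_cancel₀ _ (hq τ)]
  have h2 : (fun τ : ℍ ↦ Function.Periodic.qParam 1 τ * F τ) =o[atImInfty]
      fun _ : ℍ ↦ (1 : ℝ) * (1 : ℝ) :=
    ((Asymptotics.isLittleO_one_iff ℝ).mpr h0).mul_isBigO hb
  rw [mul_one] at h2
  rw [h1]
  exact (Asymptotics.isLittleO_one_iff ℝ).mp h2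

lemma etaPoincare_mdifferentiable : MDiff etaPoincare := by
  rw [UpperHalfPlane.mdifferentiable_iff]
  have hf : ∀ τ : ℂ, 0 < τ.im → HasSum (fun n : ℕ ↦
      ((n : ℂ) ^ 13 * invEulerCoeff (n + 1) + poincareCoeff n) *
      Complex.exp (2 * Real.pi * Complex.I * (n + (0 : ℤ)) * τ)) ((etaPoincare ∘ ofComplex) τ) := by
    intro τ hτ
    rw [Function.comp, ofComplex_apply_of_im_pos hτ]
    refine (hasSum_etaPoincare ⟨τ, hτ⟩).congr_fun fun n ↦ ?_
    rw [← Complex.exp_nat_mul]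
    congr 2
    push_cast
    ring
  exact fun τ hτ ↦ (differentiableAt_of_hasSum_qSeries hf hτ).differentiableWithinAt

lemma etaPoincare_slash (γ : SL(2, ℤ)) : etaPoincare ∣[(14 : ℤ)] γ = etaPoincare := by
  refine slash_action_generators_SL2Z ?_ ?_ γ
  · ext τ
    rw [SL_slash_apply]
    have hP := poincareSeries_smul ModularGroup.S τ
    have hE := etaDeriv_neg_one_div τ.im_pos
    have hS : ((ModularGroup.S • τ : ℍ) : ℂ) = -1 / τ := by
      rw [modular_S_smul]
      simp [neg_div, inv_neg]
    rw [ModularGroup.denom_S] at hP ⊢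
    have hτ : (τ : ℂ) ^ (14 : ℤ) ≠ 0 := zpow_ne_zero _ τ.ne_zero
    have hτ0 := τ.ne_zero
    have hE' : etaDeriv (-1 / (τ : ℂ)) = (τ : ℂ) ^ (14 : ℤ) * etaDeriv τ := hE
    rw [etaPoincare, hP, hS, hE', zpow_neg, etaPoincare]
    field_simp
  · ext τ
    rw [SL_slash_apply]
    have hP := poincareSeries_smul ModularGroup.T τ
    have hE := etaDeriv_add_one τ.im_pos
    have hT : ((ModularGroup.T • τ : ℍ) : ℂ) = τ + 1 := by
      rw [modular_T_smul, coe_vadd, add_comm]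
      simp
    have hd : denom ModularGroup.T τ = 1 := by simp [denom]
    rw [hd] at hP ⊢
    have hE' : etaDeriv ((τ : ℂ) + 1) = etaDeriv τ := hE
    rw [etaPoincare, hP, hT, hE', etaPoincare]
    simp

/-- `etaPoincare` as a cusp form of weight `14` and level one. -/
noncomputable def etaPoincareCuspForm : CuspForm 𝒮ℒ 14 where
  toFun := etaPoincare
  slash_action_eq' A hA := by
    obtain ⟨A, rfl⟩ := hA
    exact etaPoincare_slash A
  holo' := etaPoincare_mdifferentiable
  zero_at_cusps' hc := by
    rw [Subgroup.IsArithmetic.isCusp_iff_isCusp_SL2Z] at hc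
    rw [OnePoint.isZeroAt_iff_forall_SL2Z hc]
    intro γ _
    rw [etaPoincare_slash]
    exact etaPoincare_isZeroAtImInfty

lemma cuspForm_weight_fourteen_eq_zero (f : CuspForm 𝒮ℒ 14) : f = 0 := by
  have h2 : ∀ g : ModularForm 𝒮ℒ (14 - 12), g = 0 :=
    rank_zero_iff_forall_zero.mp ModularForm.levelOne_weight_two_rank_zero
  exact CuspForm.discriminantEquiv.injective ((h2 _).trans (map_zero _).symm)

lemma etaPoincare_coeff_eq_zero (n : ℕ) : (n : ℂ) ^ 13 * invEulerCoeff (n + 1) + poincareCoeff n = 0 := by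
  have h0 (τ : ℍ) : etaPoincare τ = 0 :=
    DFunLike.congr_fun (cuspForm_weight_fourteen_eq_zero etaPoincareCuspForm) τ
  have h1 := ModularFormClass.qExpansion_coeff_unique one_pos one_mem_strictPeriods_SL
    (f := (0 : CuspForm 𝒮ℒ 14))
    (c := fun n ↦ (n : ℂ) ^ 13 * invEulerCoeff (n + 1) + poincareCoeff n) (fun τ ↦ by
      have := hasSum_etaPoincare τ
      rw [h0] at this
      simpa only [qParam_one_eq, smul_eq_mul] using! this) n
  have h2 := ModularFormClass.qExpansion_coeff_unique one_pos one_mem_strictPeriods_SL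
    (f := (0 : CuspForm 𝒮ℒ 14)) (c := fun _ ↦ 0) (fun τ ↦ by
      simpa only [zero_smul] using! hasSum_zero) n
  exact h1.trans h2.symm

/-- Rademacher's exact formula for the coefficients of `η ^ (-24)`. -/
lemma etaCoeff_eq_tsum_rademacherTerm {n : ℕ} (hn : 0 < n) : etaCoeff n =
    ((2 * Real.pi / (n : ℝ) ^ (13 / 2 : ℝ) : ℝ) : ℂ) * ∑' k : ℕ+, rademacherTerm n k := by
  have h := etaPoincare_coeff_eq_zero n
  have hc := etaCoeff_sub_one (n + 1)
  rw [show ((n + 1 : ℕ) : ℤ) + (-1 : ℤ) = n by push_cast; ring] at hc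
  rw [← hc, poincareCoeff_eq] at h
  have hn' : (0 : ℝ) < n := by exact_mod_cast hn
  have hr0 : (0 : ℝ) < (n : ℝ) ^ (13 / 2 : ℝ) := by positivity
  have hr : ((n : ℝ) ^ (13 / 2 : ℝ)) ^ 2 = (n : ℝ) ^ 13 := by
    rw [← Real.rpow_natCast, ← Real.rpow_mul hn'.le, ← Real.rpow_natCast]
    norm_num
  have hrC : (((n : ℝ) ^ (13 / 2 : ℝ) : ℝ) : ℂ) ^ 2 = (n : ℂ) ^ 13 := by exact_mod_cast hr
  have hrne : (((n : ℝ) ^ (13 / 2 : ℝ) : ℝ) : ℂ) ≠ 0 := by exact_mod_cast hr0.ne'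
  rw [← hrC] at h
  push_cast at h ⊢
  field_simp
  refine mul_left_cancel₀ hrne ?_
  linear_combination h

end CuspForm

section Asymptotics

open Filter Topology Asymptotics

lemma rademacherTerm_one (n : ℕ) :
    rademacherTerm n 1 = (besselI 13 (4 * Real.pi * √n) : ℂ) := by
  have h1 : dedekindOmega 0 1 = 1 := by
    simp [dedekindOmega, dedekindSum, sawtooth]
  simp [rademacherTerm, h1]

lemma norm_tsum_rademacherTerm_sub_le (n : ℕ) :
    ‖∑' k : ℕ+, rademacherTerm n k - besselI 13 (4 * Real.pi * √n)‖ ≤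
      (∑' k : ℕ+, 2 ^ 13 * (1 / ((k : ℕ) : ℝ) ^ 13)) * besselI 13 (2 * Real.pi * √n) := by
  have hpi := Real.pi_pos
  rw [(summable_rademacherTerm n).tsum_eq_add_tsum_ite 1, rademacherTerm_one, add_sub_cancel_left,
    ← tsum_mul_right]
  have hI : 0 ≤ besselI 13 (2 * Real.pi * √n) := tsum_nonneg fun m ↦ by positivity
  refine tsum_of_norm_bounded
    (((summable_one_div_pnat_pow.mul_left (2 ^ 13)).mul_right _).hasSum) fun k ↦ ?_
  split_ifs with hk
  · rw [norm_zero]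
    positivity
  · refine (norm_rademacherTerm_le n k).trans ?_
    have hk0 : (0 : ℝ) < (k : ℕ) := by exact_mod_cast k.pos
    have hk2 : (2 : ℝ) ≤ (k : ℕ) := by
      have : (k : ℕ) ≠ 1 := fun h ↦ hk (PNat.coe_eq_one_iff.mp h)
      have := k.pos
      exact_mod_cast (show 2 ≤ (k : ℕ) by omega)
    have h := besselI_mul_le 13 (t := 2 / ((k : ℕ) : ℝ)) (x := 2 * Real.pi * √n) (by positivity)
      ((div_le_one hk0).mpr hk2) (by positivity)
    rw [div_pow, div_eq_mul_one_div (2 ^ 13 : ℝ)] at h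
    refine le_trans (le_of_eq ?_) h
    congr 1
    ring

lemma tendsto_two_pi_mul_sqrt (c : ℝ) (hc : 0 < c) :
    Tendsto (fun n : ℕ ↦ c * Real.pi * √n) atTop atTop :=
  (Real.tendsto_sqrt_atTop.comp tendsto_natCast_atTop_atTop).const_mul_atTop (by positivity)

lemma besselI_div_isBigO :
    (fun n : ℕ ↦ besselI 13 (2 * Real.pi * √n) / besselI 13 (4 * Real.pi * √n)) =O[atTop]
      fun n : ℕ ↦ 1 / Real.exp (2 * Real.pi * √n) := by
  have h1 := (tendsto_besselI 13).comp (tendsto_two_pi_mul_sqrt 2 (by norm_num))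
  have h2 := (tendsto_besselI 13).comp (tendsto_two_pi_mul_sqrt 4 (by norm_num))
  have h3 := h1.div h2 one_ne_zero
  have hO := (h3.isBigO_one ℝ).mul
    (isBigO_refl (fun n : ℕ ↦ √2 * (1 / Real.exp (2 * Real.pi * √n))) atTop)
  refine (hO.trans ?_).congr' ?_ EventuallyEq.rfl
  · simp_rw [one_mul]
    exact (isBigO_refl _ _).const_mul_left _
  · filter_upwards [eventually_gt_atTop 0] with n hn
    have hpi := Real.pi_pos
    have hn' : (0 : ℝ) < √n := Real.sqrt_pos.mpr (by exact_mod_cast hn)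
    have hI := (besselI_pos 13 (x := 4 * Real.pi * √n) (by positivity)).ne'
    have hs : √(2 * Real.pi * (4 * Real.pi * √n)) = √2 * √(2 * Real.pi * (2 * Real.pi * √n)) := by
      rw [← Real.sqrt_mul (by norm_num)]
      congr 1
      ring
    have hs0 : √(2 * Real.pi * (2 * Real.pi * √n)) ≠ 0 := (Real.sqrt_pos.mpr (by positivity)).ne'
    have h20 : √(2 : ℝ) ≠ 0 := (Real.sqrt_pos.mpr (by norm_num)).ne'
    have he : Real.exp (-(4 * Real.pi * √n)) =
        Real.exp (-(2 * Real.pi * √n)) * (1 / Real.exp (2 * Real.pi * √n)) := by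
      rw [one_div, ← Real.exp_neg, ← Real.exp_add]
      congr 1
      ring
    have he0 := (Real.exp_pos (-(2 * Real.pi * √n))).ne'
    have he1 := (Real.exp_pos (2 * Real.pi * √n)).ne'
    simp only [Function.comp, Pi.div_apply]
    rw [hs, he]
    field_simp

/-- The relative error in approximating `etaCoeff` by its main term. -/
noncomputable def etaRelError (n : ℕ) : ℂ :=
  (∑' k : ℕ+, rademacherTerm n k - besselI 13 (4 * Real.pi * √n)) / besselI 13 (4 * Real.pi * √n)

lemma etaRelError_isBigO :
    etaRelError =O[atTop] fun n : ℕ ↦ 1 / Real.exp (2 * Real.pi * √n) := by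
  refine (IsBigO.of_bound (∑' k : ℕ+, 2 ^ 13 * (1 / ((k : ℕ) : ℝ) ^ 13)) ?_).trans besselI_div_isBigO
  filter_upwards [eventually_gt_atTop 0] with n hn
  have hpi := Real.pi_pos
  have hn' : (0 : ℝ) < √n := Real.sqrt_pos.mpr (by exact_mod_cast hn)
  have hI4 := besselI_pos 13 (x := 4 * Real.pi * √n) (by positivity)
  have hI2 := besselI_pos 13 (x := 2 * Real.pi * √n) (by positivity)
  rw [etaRelError, norm_div, Complex.norm_real, Real.norm_of_nonneg hI4.le,
    Real.norm_of_nonneg (by positivity), ← mul_div_assoc]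
  gcongr
  exact norm_tsum_rademacherTerm_sub_le n

lemma etaCoeff_eq_mainTerm_mul {n : ℕ} (hn : 0 < n) :
    etaCoeff n = (etaMainTerm n : ℂ) * (1 + etaRelError n) := by
  have hpi := Real.pi_pos
  have hn' : (0 : ℝ) < √n := Real.sqrt_pos.mpr (by exact_mod_cast hn)
  have hI4 := besselI_pos 13 (x := 4 * Real.pi * √n) (by positivity)
  have hI4' : (besselI 13 (4 * Real.pi * √n) : ℂ) ≠ 0 := by exact_mod_cast hI4.ne'
  rw [etaCoeff_eq_tsum_rademacherTerm hn, etaMainTerm, etaRelError, Complex.ofReal_mul,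
    one_add_div hI4', add_sub_cancel, mul_assoc, mul_div_cancel₀ _ hI4']

lemma etaCoeff_isEquivalent : IsEquivalent atTop (fun n : ℕ ↦ etaCoeff n)
    (fun n : ℕ ↦ ((2 * Real.pi / (n : ℝ) ^ (13 / 2 : ℝ) *
      (Real.exp (4 * Real.pi * √n) / √(8 * Real.pi ^ 2 * √n)) : ℝ) : ℂ)) := by
  refine isEquivalent_of_tendsto_one ?_
  have hexp : Tendsto (fun n : ℕ ↦ 1 / Real.exp (2 * Real.pi * √n)) atTop (𝓝 0) := by
    simp_rw [one_div]
    exact (Real.tendsto_exp_atTop.comp (tendsto_two_pi_mul_sqrt 2 (by norm_num))).inv_tendsto_atTop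
  have h1 : Tendsto (fun n ↦ 1 + etaRelError n) atTop (𝓝 1) := by
    simpa using (etaRelError_isBigO.trans_tendsto hexp).const_add 1
  have h2 := (Complex.continuous_ofReal.tendsto _).comp
    ((tendsto_besselI 13).comp (tendsto_two_pi_mul_sqrt 4 (by norm_num)))
  have h3 := h2.mul h1
  rw [Complex.ofReal_one, mul_one] at h3
  refine h3.congr' ?_
  filter_upwards [eventually_gt_atTop 0] with n hn
  have hpi := Real.pi_pos
  have hn0 : (0 : ℝ) < n := by exact_mod_cast hn
  have hn' : (0 : ℝ) < √n := Real.sqrt_pos.mpr hn0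
  have hreal : besselI 13 (4 * Real.pi * √n) *
      (√(2 * Real.pi * (4 * Real.pi * √n)) * Real.exp (-(4 * Real.pi * √n))) =
      etaMainTerm n / (2 * Real.pi / (n : ℝ) ^ (13 / 2 : ℝ) *
        (Real.exp (4 * Real.pi * √n) / √(8 * Real.pi ^ 2 * √n))) := by
    have hs : 2 * Real.pi * (4 * Real.pi * √n) = 8 * Real.pi ^ 2 * √n := by ring
    have hs0 : √(8 * Real.pi ^ 2 * √n) ≠ 0 := (Real.sqrt_pos.mpr (by positivity)).ne'
    have hr0 : (n : ℝ) ^ (13 / 2 : ℝ) ≠ 0 := by positivity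
    rw [hs, etaMainTerm, Real.exp_neg]
    field_simp
  simp only [Function.comp, Pi.div_apply]
  rw [etaCoeff_eq_mainTerm_mul hn, hreal, Complex.ofReal_div]
  ring

end Asymptotics

theorem lemma1p4 :
    -- the numbers `etaCoeff n` are the coefficients of the expansion of `η⁻²⁴` in powers of `q`
    (∀ τ : ℂ, 0 < τ.im →
      HasSum (fun n : ℤ => etaCoeff n * Complex.exp (2 * Real.pi * Complex.I * n * τ))
        (ModularForm.eta τ ^ (-24 : ℤ))) ∧
    (∀ n : ℤ, n < -1 → etaCoeff n = 0) ∧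
    etaCoeff (-1) = 1 ∧
    etaCoeff 0 = 24 ∧
    (∀ n : ℕ, 0 < n →
      Summable (rademacherTerm n) ∧
      etaCoeff n =
        ((2 * Real.pi / (n : ℝ) ^ (13 / 2 : ℝ) : ℝ) : ℂ) * ∑' k : ℕ+, rademacherTerm n k) ∧
    (∃ ε : ℕ → ℂ,
      ε =O[Filter.atTop] (fun n : ℕ => 1 / Real.exp (2 * Real.pi * Real.sqrt n)) ∧
      ∀ n : ℕ, 0 < n → etaCoeff n = (etaMainTerm n : ℂ) * (1 + ε n)) ∧
    Asymptotics.IsEquivalent Filter.atTop (fun n : ℕ => etaCoeff n)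
      (fun n : ℕ => ((2 * Real.pi / (n : ℝ) ^ (13 / 2 : ℝ) *
        (Real.exp (4 * Real.pi * Real.sqrt n) /
          Real.sqrt (8 * Real.pi ^ 2 * Real.sqrt n)) : ℝ) : ℂ)) := by
  refine ⟨fun τ hτ ↦ hasSum_etaCoeff hτ, etaCoeff_of_lt, ?_, ?_, fun n hn ↦
    ⟨summable_rademacherTerm n, etaCoeff_eq_tsum_rademacherTerm hn⟩,
    ⟨etaRelError, etaRelError_isBigO, fun n hn ↦ etaCoeff_eq_mainTerm_mul hn⟩, etaCoeff_isEquivalent⟩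
  · simpa [invEulerCoeff_zero] using etaCoeff_sub_one 0
  · simpa [invEulerCoeff_one] using etaCoeff_sub_one 1
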